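/- For integers $k\ge 1$, $n\ge 0$, a Gallai $k$-colouring of $K_n$ is a map from the edges of $K_n$ to $\{1,\dots,k\}$ for which no triangle has three edges of pairwise different colours. Let $g(k)$ be the least non-negative integer $N$ such that for every $n\ge N$ and all non-negative integers $e_1,\dots,e_k$ with $\sum_{i=1}^k e_i=\binom n2$ there is a Gallai $k$-colouring of $K_n$ in which exactly $e_i$ edges have colour $i$ for every $i\in\{1,\dots,k\}$. Then $g(k)$ is well defined (such an $N$ exists) for every $k\ge 1$, and $$g(k)=\Theta\!\left(\frac{k^{1.5}}{(\log k)^{0.5}}\right)\qquad (k\to\infty),$$ that is, there are absolute constants $c,C>0$ and $k_0$ such that $c\,k^{1.5}/(\log k)^{0.5}\le g(k)\le C\,k^{1.5}/(\log k)^{0.5}$ for all integers $k\ge k_0$. -/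

import Mathlib

/-- A colouring `C` of the edges of the complete graph on `V` contains a rainbow triangle: there are
three vertices, pairwise adjacent in the complete graph (that is, pairwise distinct), such that the
three edges between them receive three different colours. -/
def HasRainbowTriangle {V K : Type*} (C : SimpleGraph.TopEdgeLabeling V K) : Prop :=
  ∃ (x y z : V) (hxy : (⊤ : SimpleGraph V).Adj x y) (hyz : (⊤ : SimpleGraph V).Adj y z)
    (hxz : (⊤ : SimpleGraph V).Adj x z),
    C.get x y hxy ≠ C.get y z hyz ∧ C.get y z hyz ≠ C.get x z hxz ∧
      C.get x y hxy ≠ C.get x z hxz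

/-- A Gallai colouring is an edge colouring of a complete graph without rainbow triangles. -/
def IsGallaiColouring {V K : Type*} (C : SimpleGraph.TopEdgeLabeling V K) : Prop :=
  ¬ HasRainbowTriangle C

/-- `C` has colour distribution `e`: exactly `e i` edges have colour `i`, for every colour `i`. -/
def HasColourDistribution {V K : Type*} (C : SimpleGraph.TopEdgeLabeling V K) (e : K → ℕ) : Prop :=
  ∀ i : K, {x : (⊤ : SimpleGraph V).edgeSet | C x = i}.ncard = e i

/-- For every `n ≥ N`, every sequence of `k` non-negative integers with sum `n.choose 2` is the
colour distribution of some Gallai colouring of the complete graph on `n` vertices. -/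
def AllDistributionsGallaiFrom (k N : ℕ) : Prop :=
  ∀ n : ℕ, N ≤ n → ∀ e : Fin k → ℕ, ∑ i, e i = n.choose 2 →
    ∃ C : SimpleGraph.TopEdgeLabeling (Fin n) (Fin k),
      IsGallaiColouring C ∧ HasColourDistribution C e

/-- The Gallai threshold `g(k)`: the least `N` such that for every `n ≥ N` all colour distributions
with `k` colours are realised by Gallai colourings of `K_n`, and `⊤` if there is no such `N`. -/
noncomputable def gallaiThreshold (k : ℕ) : ℕ∞ :=
  sInf ((fun N : ℕ => (N : ℕ∞)) '' {N : ℕ | AllDistributionsGallaiFrom k N})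

/-! Upper bound. Joining two Gallai colourings by edges of one colour gives a Gallai colouring, so a
vertex whose edges to the earlier vertices share a colour (a star) can always be added. If all that
remains is a list of stars, give each, largest first, to a colour that still needs that many edges.
This succeeds when every star size `s` satisfies `k(s-1) < s + (sum of the smaller stars)`
(`distributes_of_sortedGE`). The stars `0, ..., n-1` of a single `K_n` satisfy this only for `s` of
order `k` and above, so many small stars must be created.

They come from blocks. While some colour has at least `Q ≈ n²/k` edges, a block of `b ≈ Q/m`
vertices is split off from the current `m` vertices, all edges between block and rest taking that
colour; the block's interior contributes the stars `0, ..., b-1`. As `m` falls from order `n` to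
order `n/t`, the total size of these stars is at least of order `∑ b² ≈ Q ∑ b/m ≈ Q log t`. The
greedy rule needs this to be of order `k²`; with `t` a power of `k` this says `n² log k ≳ k³`
(`BlockState.step`, `BlockState.distributes`).

Lower bound. In a Gallai colouring at most two colours span connected graphs, and a union of
disconnected colours is disconnected. Hence every vertex set `S` has a cut using at most two
colours, each with at least `|S| - 1` edges in `S`. Take half of the colours with only `k/8` edges
each and the others with at most `E ≈ n²/k`. Cuts of sets larger than `k/8 + 1` then avoid the rare
colours, so a cut with smaller side `R` has `|R||S| ≤ 8E`, and at most `|R|² ≤ 8E |R|/|S|` ordered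
pairs are lost inside `R`. These losses telescope to `8E log n`, which bounds the rare edges apart
from a final `O(k²)` term. If `n² log n` is a small multiple of `k³`, this is too little room for
the rare colours (`IsGallaiMap.card_colourPairsIn_le`). -/

/-! ### Colourings as symmetric maps, and their joins -/

/-- A symmetric map on pairs of vertices without rainbow triangles. -/
structure IsGallaiMap {V K : Type*} (c : V → V → K) : Prop where
  symm : ∀ x y, c x y = c y x
  tri : ∀ x y z, x ≠ y → y ≠ z → x ≠ z → c x y = c y z ∨ c y z = c x z ∨ c x y = c x z

open scoped Classical in
/-- The ordered pairs of distinct vertices whose colour lies in `I`. -/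
noncomputable def colourPairs {V K : Type*} [Fintype V] (c : V → V → K) (I : Set K) :
    Finset (V × V) :=
  Finset.univ.filter fun p => p.1 ≠ p.2 ∧ c p.1 p.2 ∈ I

/-- Some Gallai colouring of the complete graph on `m` vertices has colour distribution `f`. -/
def Realizable {K : Type*} (m : ℕ) (f : K → ℕ) : Prop :=
  ∃ c : Fin m → Fin m → K, IsGallaiMap c ∧ ∀ i, (colourPairs c {i}).card = 2 * f i

open scoped Classical in
lemma two_mul_ncard_colour {V K : Type*} [Fintype V] (C : SimpleGraph.TopEdgeLabeling V K)
    (c : V → V → K) (hc : ∀ x y (h : x ≠ y), C.get x y h = c x y) (i : K) :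
    2 * {x : (⊤ : SimpleGraph V).edgeSet | C x = i}.ncard = (colourPairs c {i}).card := by
  have h1 : {x : (⊤ : SimpleGraph V).edgeSet | C x = i}.ncard
      = (C.labelGraph i).edgeFinset.card := by
    rw [← Set.ncard_coe_finset, ← Set.ncard_image_of_injective _ Subtype.val_injective]
    congr 1
    ext e
    induction e using Sym2.inductionOn with
    | hf x y =>
      simp only [Set.mem_image, Subtype.exists, SimpleGraph.coe_edgeFinset,
        SimpleGraph.mem_edgeSet, SimpleGraph.EdgeLabeling.labelGraph_adj]
      constructor
      · rintro ⟨a, ha, hb, rfl⟩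
        exact ⟨ha, hb⟩
      · rintro ⟨ha, hb⟩
        exact ⟨_, ha, hb, rfl⟩
  rw [h1, SimpleGraph.two_mul_card_edgeFinset]
  congr 1
  ext ⟨x, y⟩
  simp only [colourPairs, Finset.mem_filter, Finset.mem_univ, true_and,
    SimpleGraph.TopEdgeLabeling.labelGraph_adj, Set.mem_singleton_iff]
  constructor
  · rintro ⟨h, h'⟩
    exact ⟨h, by rw [← hc x y h]; exact h'⟩
  · rintro ⟨h, h'⟩
    exact ⟨h, by rw [← h']; exact hc x y h⟩

lemma exists_gallaiColouring_iff_realizable {K : Type*} [Nonempty K] (n : ℕ) (e : K → ℕ) :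
    (∃ C : SimpleGraph.TopEdgeLabeling (Fin n) K,
      IsGallaiColouring C ∧ HasColourDistribution C e) ↔ Realizable n e := by
  classical
  constructor
  · rintro ⟨C, hG, hD⟩
    -- The diagonal value is arbitrary: both the triangle condition and `colourPairs` only see
    -- distinct vertices.
    let c : Fin n → Fin n → K := fun x y =>
      if h : x ≠ y then C.get x y h else Classical.arbitrary K
    have hc : ∀ x y (h : x ≠ y), C.get x y h = c x y := fun x y h => by simp [c, h]
    refine ⟨c, ⟨?_, ?_⟩, fun i => ?_⟩
    · intro x y
      by_cases h : x = y
      · rw [h]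
      · rw [← hc x y h, ← hc y x (Ne.symm h), C.get_comm]
    · intro x y z hxy hyz hxz
      by_contra! hcon
      refine hG ⟨x, y, z, hxy, hyz, hxz, ?_⟩
      rw [hc x y hxy, hc y z hyz, hc x z hxz]
      exact hcon
    · rw [← two_mul_ncard_colour C c hc, hD i]
  · rintro ⟨c, hc, hD⟩
    let C : SimpleGraph.TopEdgeLabeling (Fin n) K :=
      SimpleGraph.EdgeLabeling.mk (fun x y _ => c x y) (fun x y _ => hc.symm y x)
    have hC : ∀ x y (h : x ≠ y), C.get x y h = c x y := fun x y h => rfl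
    refine ⟨C, ?_, fun i => ?_⟩
    · rintro ⟨x, y, z, hxy, hyz, hxz, h1, h2, h3⟩
      rw [hC, hC] at h1 h2 h3
      rcases hc.tri x y z hxy hyz hxz with h | h | h
      exacts [h1 h, h2 h, h3 h]
    · have := two_mul_ncard_colour C c hC i
      rw [hD i] at this
      omega

lemma Realizable.of_equiv {V K : Type*} [Fintype V] {m : ℕ} (e : V ≃ Fin m) (c : V → V → K)
    (hc : IsGallaiMap c) {f : K → ℕ} (hf : ∀ i, (colourPairs c {i}).card = 2 * f i) :
    Realizable m f := by
  refine ⟨fun x y => c (e.symm x) (e.symm y), ⟨fun x y => hc.symm _ _, ?_⟩, fun i => ?_⟩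
  · intro x y z h1 h2 h3
    exact hc.tri _ _ _ (by simpa) (by simpa) (by simpa)
  · rw [← hf i]
    refine Finset.card_equiv (e.prodCongr e).symm ?_
    rintro ⟨x, y⟩
    simp [colourPairs]

lemma Realizable.zero {K : Type*} : Realizable 0 (0 : K → ℕ) :=
  ⟨fun x => x.elim0, ⟨fun x => x.elim0, fun x => x.elim0⟩, fun i => by
    rw [colourPairs, Finset.univ_eq_empty]; simp⟩

lemma Realizable.one {K : Type*} [Nonempty K] : Realizable 1 (0 : K → ℕ) := by
  refine ⟨fun _ _ => Classical.arbitrary K, ⟨fun _ _ => rfl, fun _ _ _ _ _ _ => .inl rfl⟩,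
    fun i => ?_⟩
  simp [colourPairs, Subsingleton.elim (_ : Fin 1) 0]

/-- Two Gallai colourings joined by edges of a single colour. -/
lemma Realizable.join {K : Type*} [DecidableEq K] {a b : ℕ} {f g : K → ℕ}
    (hf : Realizable a f) (hg : Realizable b g) (j : K) :
    Realizable (a + b) (f + g + Pi.single j (a * b)) := by
  classical
  obtain ⟨c, hc, hcf⟩ := hf
  obtain ⟨d, hd, hdg⟩ := hg
  let q : Fin a ⊕ Fin b → Fin a ⊕ Fin b → K := fun x y =>
    Sum.elim (fun x => Sum.elim (fun y => c x y) (fun _ => j) y)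
      (fun x => Sum.elim (fun _ => j) (fun y => d x y) y) x
  refine Realizable.of_equiv (finSumFinEquiv (m := a) (n := b)) q ⟨?_, ?_⟩ fun i => ?_
  · rintro (x | x) (y | y)
    exacts [hc.symm x y, rfl, rfl, hd.symm x y]
  · rintro (x | x) (y | y) (z | z) h1 h2 h3 <;> simp only [q, Sum.elim_inl, Sum.elim_inr]
    · exact hc.tri x y z (by simpa using h1) (by simpa using h2) (by simpa using h3)
    all_goals try tauto
    exact hd.tri x y z (by simpa using h1) (by simpa using h2) (by simpa using h3)
  · have h1 := hcf i
    have h2 := hdg i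
    simp only [colourPairs, Finset.card_filter, Fintype.sum_prod_type, Fintype.sum_sum_type,
      Set.mem_singleton_iff] at h1 h2 ⊢
    simp only [q, Sum.elim_inl, Sum.elim_inr, ne_eq, Sum.inl.injEq, Sum.inr.injEq, reduceCtorEq,
      not_false_eq_true, true_and, Finset.sum_add_distrib, Pi.add_apply] at h1 h2 ⊢
    rw [h1, h2]
    by_cases hij : j = i
    · subst hij
      simp
      ring
    · simp [hij]
      ring

/-! ### Greedy distribution of stars among colours -/

/-- The numbers in `L` can be distributed among the colours so that colour `i` gets total `h i`. -/
def Distributes {K : Type*} [DecidableEq K] : List ℕ → (K → ℕ) → Prop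
  | [], h => h = 0
  | u :: L, h => ∃ (i : K) (h' : K → ℕ), Distributes L h' ∧ h = h' + Pi.single i u

section Distributes

variable {K : Type*} [DecidableEq K]

lemma Distributes.perm {L L' : List ℕ} (hp : L.Perm L') :
    ∀ {h : K → ℕ}, Distributes L h → Distributes L' h := by
  induction hp with
  | nil => exact fun h => h
  | cons x _ ih =>
    rintro h ⟨i, h', h1, rfl⟩
    exact ⟨i, h', ih h1, rfl⟩
  | swap x y l =>
    rintro h ⟨i, h', ⟨j, h'', h1, rfl⟩, rfl⟩
    exact ⟨j, h'' + Pi.single i y, ⟨i, h'', h1, rfl⟩, add_right_comm _ _ _⟩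
  | trans _ _ ih1 ih2 => exact fun h => ih2 (ih1 h)

lemma Distributes.exists_add {L L' : List ℕ} :
    ∀ {h : K → ℕ}, Distributes (L ++ L') h →
      ∃ h1 h2, Distributes L h1 ∧ Distributes L' h2 ∧ h = h1 + h2 := by
  induction L with
  | nil => exact fun h => ⟨0, _, rfl, h, (zero_add _).symm⟩
  | cons u L ih =>
    rintro h ⟨i, h', h1, rfl⟩
    obtain ⟨a, b, ha, hb, rfl⟩ := ih h1
    exact ⟨a + Pi.single i u, b, ⟨i, a, ha, rfl⟩, hb, add_right_comm _ _ _⟩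

lemma Distributes.single {u : ℕ} {h : K → ℕ} (hh : Distributes [u] h) :
    ∃ i, h = Pi.single i u := by
  obtain ⟨i, h', h1, rfl⟩ := hh
  exact ⟨i, by rw [show h' = 0 from h1, zero_add]⟩

/-- Order the vertices; the star of size `t` consists of the edges from vertex `t` to its `t`
predecessors. -/
lemma Distributes.realizable_range [Nonempty K] {b : ℕ} :
    ∀ {h : K → ℕ}, Distributes (List.range b) h → Realizable b h := by
  induction b with
  | zero => rintro h rfl; exact Realizable.zero
  | succ b ih =>
    intro h hh
    rw [List.range_succ] at hh
    obtain ⟨h1, h2, hh1, hh2, rfl⟩ := hh.exists_add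
    obtain ⟨i, rfl⟩ := hh2.single
    simpa using (ih hh1).join Realizable.one i

/-- Largest first, every number can be given to a colour that still needs at least this much. -/
lemma distributes_of_sortedGE [Fintype K] {L : List ℕ} :
    ∀ {f : K → ℕ}, L.Pairwise (· ≥ ·) → L.sum = ∑ i, f i →
      (∀ s ∈ L, 1 ≤ s →
        Fintype.card K * (s - 1) < s + (L.filter (· < s)).sum) → (L ≠ [] → Nonempty K) →
      Distributes L f := by
  induction L with
  | nil =>
    intro f _ hs _ _
    funext i
    simp only [List.sum_nil] at hs
    exact (Finset.sum_eq_zero_iff.1 hs.symm) i (Finset.mem_univ i)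
  | cons u L ih =>
    intro f hL hs hb hne
    have : Nonempty K := hne (by simp)
    -- If every colour needed at most `u - 1` edges, the total need would be at most `k(u-1)`, less
    -- than `u` plus the smaller stars, all of which are still to be placed.
    have hex : ∃ i, u ≤ f i := by
      by_contra! hcon
      have hu : 1 ≤ u := by have := hcon (Classical.arbitrary K); omega
      have h1 := hb u (by simp) hu
      have h2 : ∑ i, f i ≤ Fintype.card K * (u - 1) := by
        calc ∑ i, f i ≤ ∑ _i : K, (u - 1) :=
              Finset.sum_le_sum fun i _ => by have := hcon i; omega
          _ = _ := by simp
      have h3 : ((u :: L).filter (· < u)).sum ≤ L.sum := by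
        rw [List.filter_cons_of_neg (by simp)]
        exact (List.filter_sublist).sum_le_sum (by simp)
      simp only [List.sum_cons] at hs
      omega
    obtain ⟨i, hi⟩ := hex
    have hf : f = Function.update f i (f i - u) + Pi.single i u := by
      funext l
      by_cases hl : l = i
      · subst hl; simp [hi]
      · simp [hl]
    refine ⟨i, _, ih (List.pairwise_cons.1 hL).2 ?_ ?_ (fun _ => this), hf⟩
    · have : ∑ l, f l = ∑ l, Function.update f i (f i - u) l + u := by
        conv_lhs => rw [hf]
        simp [Finset.sum_add_distrib]
      simp only [List.sum_cons] at hs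
      omega
    · intro s hs' h1
      have := hb s (by simp [hs']) h1
      rwa [List.filter_cons_of_neg] at this
      simpa using (List.pairwise_cons.1 hL).1 s hs'

lemma distributes_of_forall_lt [Fintype K] [Nonempty K] {L : List ℕ} {f : K → ℕ}
    (hs : L.sum = ∑ i, f i)
    (hb : ∀ s ∈ L, 1 ≤ s → Fintype.card K * (s - 1) < s + (L.filter (· < s)).sum) :
    Distributes L f := by
  have hp : (L.mergeSort (fun a b => decide (a ≥ b))).Perm L := List.mergeSort_perm _ _
  refine Distributes.perm hp (distributes_of_sortedGE ?_ ?_ ?_ fun _ => inferInstance)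
  · exact (List.pairwise_mergeSort (le := fun a b : ℕ => decide (a ≥ b))
      (fun a b c h1 h2 => by simp at *; omega) (fun a b => by simp; omega) L).imp (by simp)
  · rw [hp.sum_eq, hs]
  · intro s h1 h2
    rw [(hp.filter _).sum_eq]
    exact hb s (hp.mem_iff.1 h1) h2

/-! ### Splitting off stars and blocks -/

/-- If `W` distributes as `h` and `f - h` is realizable on `m` vertices, then `e` is realizable
on `n` vertices: after joining blocks to each other, `K_m` and the stars with sizes in `W` remain
uncoloured. -/
def Reduces (n : ℕ) (e : K → ℕ) (m : ℕ) (f : K → ℕ) (W : List ℕ) : Prop :=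
  ∀ f' h, f = f' + h → Realizable m f' → Distributes W h → Realizable n e

lemma Reduces.refl (n : ℕ) (e : K → ℕ) : Reduces n e n e [] := by
  rintro f' h rfl h1 rfl
  simpa using h1

/-- Only the edges between the block and the rest are coloured now. The interior of the block is
deferred to `W` as its stars. -/
lemma Reduces.block [Nonempty K] {n m b : ℕ} {e f : K → ℕ} {W : List ℕ} {j : K}
    (h : Reduces n e (m + b) (f + Pi.single j (m * b)) W) :
    Reduces n e m f (W ++ List.range b) := by
  rintro f' g rfl hf' hg
  obtain ⟨g1, g2, hg1, hg2, rfl⟩ := hg.exists_add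
  refine h (f' + g2 + Pi.single j (m * b)) g1 ?_ (hf'.join hg2.realizable_range j) hg1
  abel

lemma Reduces.block_sub [Nonempty K] {n m b : ℕ} {e f : K → ℕ} {W : List ℕ} {j : K}
    (h : Reduces n e m f W) (hb : b ≤ m) (hj : b * (m - b) ≤ f j) :
    Reduces n e (m - b) (Function.update f j (f j - b * (m - b))) (W ++ List.range b) := by
  refine Reduces.block (j := j) ?_
  rw [Nat.sub_add_cancel hb]
  convert h using 1
  funext l
  by_cases hl : l = j
  · subst hl
    simp only [Pi.add_apply, Function.update_self, Pi.single_eq_same]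
    rw [mul_comm (m - b) b]
    omega
  · simp [hl]

lemma Reduces.realizable [Nonempty K] {n m : ℕ} {e f : K → ℕ} {W : List ℕ}
    (h : Reduces n e m f W) (hd : Distributes (W ++ List.range m) f) : Realizable n e := by
  obtain ⟨g1, g2, hg1, hg2, rfl⟩ := hd.exists_add
  exact h g2 g1 (add_comm _ _) hg2.realizable_range hg1

end Distributes

lemma sum_list_range (b : ℕ) : (List.range b).sum = b.choose 2 := by
  induction b with
  | zero => rfl
  | succ b ih => rw [List.range_succ, List.sum_append, ih, Nat.choose_succ_succ' b 1]; simp; omega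

lemma sum_filter_lt_range {b s : ℕ} (h : s ≤ b) :
    ((List.range b).filter (· < s)).sum = s.choose 2 := by
  induction b, h using Nat.le_induction with
  | base =>
    rw [List.filter_eq_self.2 (by simp), sum_list_range]
  | succ b hb ih =>
    rw [List.range_succ, List.filter_append, List.sum_append, ih]
    simp [Nat.not_lt.2 hb]

lemma sum_filter_lt_mono (W : List ℕ) {s t : ℕ} (h : s ≤ t) :
    (W.filter (· < s)).sum ≤ (W.filter (· < t)).sum :=
  (List.monotone_filter_right W (by simp; omega)).sum_le_sum (by simp)

lemma choose_two_add (a b : ℕ) : (a + b).choose 2 = a.choose 2 + b.choose 2 + b * a := by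
  induction b with
  | zero => simp
  | succ b ih =>
    rw [← add_assoc, Nat.choose_succ_succ' (a + b) 1, ih, Nat.choose_succ_succ' b 1]
    simp
    ring

section Reduction

variable {K : Type*} [DecidableEq K] [Fintype K] [Nonempty K]

omit [Fintype K] in
lemma Reduces.star {n m : ℕ} {e f : K → ℕ} {W : List ℕ} {j : K}
    (h : Reduces n e (m + 1) f W) (hj : m ≤ f j) :
    Reduces n e m (Function.update f j (f j - m)) W := by
  rintro f' g hf hf' hg
  refine h (f' + 0 + Pi.single j (m * 1)) g ?_ (hf'.join Realizable.one j) hg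
  have : f = Function.update f j (f j - m) + Pi.single j m := by
    funext l
    by_cases hl : l = j
    · subst hl; simp [hj]
    · simp [hl]
  rw [this, hf]
  simp only [add_zero, mul_one]
  abel

omit [Nonempty K] in
lemma sum_update_sub {f : K → ℕ} {j : K} {a : ℕ} (h : a ≤ f j) :
    ∑ i, Function.update f j (f j - a) i + a = ∑ i, f i := by
  rw [Finset.sum_update_of_mem (Finset.mem_univ j), Finset.sdiff_singleton_eq_erase,
    ← Finset.add_sum_erase Finset.univ f (Finset.mem_univ j)]
  omega

/-- Stars can be split off until no colour has a number of edges between `n` and `Q`. -/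
lemma Reduces.exists_forall_lt_or_le {n : ℕ} (hn : 1 ≤ n) {e : K → ℕ} (Q : ℕ) :
    ∀ {m : ℕ} {f : K → ℕ}, m ≤ n → Reduces n e m f [] → ∑ i, f i = m.choose 2 →
      ∃ m' ≤ m, ∃ f', Reduces n e m' f' [] ∧ ∑ i, f' i = m'.choose 2 ∧
        (∀ i, f' i < n ∨ Q ≤ f' i) ∧ ∑ i, (if Q ≤ f i then f i else 0) ≤ m'.choose 2 := by
  intro m
  induction m with
  | zero =>
    intro f _ hr hs
    have h0 : ∀ i, f i = 0 := fun i => Finset.sum_eq_zero_iff.1 hs i (Finset.mem_univ i)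
    exact ⟨0, le_rfl, f, hr, hs, fun i => .inl (by rw [h0]; omega), by simp [h0]⟩
  | succ m ih =>
    intro f hm hr hs
    by_cases hex : ∃ j, n ≤ f j ∧ f j < Q
    · obtain ⟨j, hj1, hj2⟩ := hex
      have hmj : m ≤ f j := by omega
      obtain ⟨m', hm', f', h1, h2, h3, h4⟩ := ih (by omega) (hr.star hmj) (by
        have := sum_update_sub hmj
        rw [Nat.choose_succ_succ' m 1] at hs
        simp at hs
        omega)
      -- Only a colour below `Q` loses edges, so the contribution of the large colours is unchanged.
      refine ⟨m', by omega, f', h1, h2, h3, le_trans (Finset.sum_le_sum fun i _ => ?_) h4⟩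
      by_cases hi : i = j
      · subst hi
        rw [if_neg (by omega)]
        exact Nat.zero_le _
      · simp [hi]
    · push Not at hex
      refine ⟨m + 1, le_rfl, f, hr, hs, fun i => ?_, ?_⟩
      · by_cases hi : n ≤ f i
        exacts [.inr (hex i hi), .inl (by omega)]
      · rw [← hs]
        exact Finset.sum_le_sum fun i _ => by split_ifs <;> omega

omit [DecidableEq K] [Nonempty K] in
lemma sum_le_sum_ite_add (e : K → ℕ) (Q : ℕ) :
    ∑ i, e i ≤ ∑ i, (if Q ≤ e i then e i else 0) + Fintype.card K * Q := by
  calc ∑ i, e i ≤ ∑ i, ((if Q ≤ e i then e i else 0) + Q) :=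
        Finset.sum_le_sum fun i _ => by split_ifs <;> omega
    _ = _ := by simp [Finset.sum_add_distrib]

/-! ### Iterating the block step -/

/-- The bookkeeping kept while blocks are split off: apart from the lists of colours, it records
a lower bound for the number of blocks and one for the total size of the stars in `W`. -/
structure BlockState (n : ℕ) (e : K → ℕ) (Q M m₀ m : ℕ) (f : K → ℕ) (W : List ℕ) : Prop where
  reduces : Reduces n e m f W
  sum_eq : ∑ i, f i = W.sum + m.choose 2
  lt_or_le : ∀ i, f i < 2 * n ∨ Q ≤ f i
  le_start : m ≤ m₀
  le_end : M ≤ m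
  mem_le : ∀ w ∈ W, w ≤ Q / M
  many : ∀ s ≤ Q / n, m₀ ^ 2 * s.choose 2 ≤ 4 * Q * (W.filter (· < s)).sum + m ^ 2 * s.choose 2
  large : (Q : ℝ) * (Real.log m₀ - Real.log m) ≤ 16 * W.sum

/-- The logarithm drops by at most `b/(m-b) ≤ 2b/m`, and `Q ≤ (b+1)m` turns this into `2b(b+1)`, at
most `8b(b-1)` since `b ≥ 2`. Thus each block's stars pay for its share of the telescoping
logarithm. -/
lemma log_sub_log_sub_le {Q m b : ℝ} (hm : 0 < m) (hb : 2 ≤ b) (hbm : 2 * b ≤ m) (hQ : 0 ≤ Q)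
    (hQb : Q ≤ (b + 1) * m) : Q * (Real.log m - Real.log (m - b)) ≤ 16 * (b * (b - 1) / 2) := by
  have h1 : 0 < m - b := by linarith
  have h2 : Real.log m - Real.log (m - b) ≤ b / (m - b) := by
    rw [← Real.log_div hm.ne' h1.ne']
    refine (Real.log_le_sub_one_of_pos (by positivity)).trans (le_of_eq ?_)
    field_simp
    ring
  have h3 : b / (m - b) ≤ 2 * b / m := by
    rw [div_le_div_iff₀ h1 hm]
    nlinarith
  calc Q * (Real.log m - Real.log (m - b)) ≤ Q * (2 * b / m) :=
        mul_le_mul_of_nonneg_left (h2.trans h3) hQ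
    _ ≤ ((b + 1) * m) * (2 * b / m) := by gcongr
    _ = (b + 1) * (2 * b) := by field_simp
    _ ≤ _ := by nlinarith

lemma BlockState.step {n : ℕ} {e : K → ℕ} {Q M m₀ m : ℕ} {f : K → ℕ} {W : List ℕ}
    (h : BlockState n e Q M m₀ m f W) (hm₀ : m₀ ≤ n) (hmM : 2 * M ≤ m) (hn : 0 < n) (hM : 0 < M)
    (hnQ : 2 * n ≤ Q) (hk : Fintype.card K * (2 * n) < (2 * M).choose 2) (hQn : Q ^ 2 ≤ n * M ^ 2)
    (hQM : Q ≤ M ^ 2) : ∃ b f' W', 0 < b ∧ b ≤ m ∧ BlockState n e Q M m₀ (m - b) f' W' := by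
  -- Colours with fewer than `2n` edges cannot account for all `(2M).choose 2` edges still present.
  obtain ⟨j, hj⟩ : ∃ j, Q ≤ f j := by
    by_contra! hcon
    have h1 : ∑ i, f i ≤ Fintype.card K * (2 * n) := by
      calc ∑ i, f i ≤ ∑ _i : K, 2 * n := Finset.sum_le_sum fun i _ => by
            rcases h.lt_or_le i with h | h
            · exact h.le
            · exact absurd h (hcon i).not_ge
        _ = _ := by simp
    have h2 := Nat.choose_le_choose 2 hmM
    have := h.sum_eq
    omega
  have hm : 0 < m := by omega
  have hmn : m ≤ n := h.le_start.trans hm₀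
  -- A colour with at least `2Q` edges gives up about `Q` and keeps at least `Q`; one with between
  -- `Q` and `2Q` is used up as far as possible. Thus no colour is left between `2n` and `Q`.
  obtain ⟨b, hbf, hb2, hb1, hleft, hbn⟩ : ∃ b, b * m ≤ f j ∧ b * m ≤ 2 * Q ∧ Q < (b + 1) * m ∧
      (f j < (b + 1) * m ∨ Q + b * m ≤ f j) ∧ Q / n ≤ b := by
    by_cases hf : 2 * Q ≤ f j
    · have h1 := Nat.div_mul_le_self Q m
      have h2 := Nat.lt_mul_div_succ Q hm
      rw [mul_comm] at h2
      exact ⟨Q / m, by omega, by omega, h2, .inr (by omega), Nat.div_le_div_left hmn hm⟩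
    · have h1 := Nat.div_mul_le_self (f j) m
      have h2 := Nat.lt_mul_div_succ (f j) hm
      rw [mul_comm] at h2
      exact ⟨f j / m, h1, by omega, by omega, .inl h2,
        (Nat.div_le_div_left hmn hm).trans (Nat.div_le_div_right hj)⟩
  have hbM : b * M ≤ Q := by nlinarith
  have hb2' : 2 ≤ b := le_trans ((Nat.le_div_iff_mul_le hn).2 hnQ) hbn
  have hbM' : b ≤ M := by
    by_contra! hcon
    nlinarith
  have hbb : b * b ≤ n := by
    have : (b * M) ^ 2 ≤ n * M ^ 2 := (Nat.pow_le_pow_left hbM 2).trans hQn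
    have : b * b * M ^ 2 ≤ n * M ^ 2 := by nlinarith
    exact Nat.le_of_mul_le_mul_right this (by positivity)
  obtain ⟨r, rfl⟩ : ∃ r, m = r + b := ⟨m - b, by omega⟩
  have hrf : b * r ≤ f j := le_trans (by nlinarith) hbf
  refine ⟨b, Function.update f j (f j - b * r), W ++ List.range b, by omega, by omega, ?_⟩
  rw [Nat.add_sub_cancel]
  refine ⟨?_, ?_, ?_, ?_, ?_, ?_, ?_, ?_⟩
  · have := h.reduces.block_sub (b := b) (j := j) (by omega) (by rwa [Nat.add_sub_cancel])
    rwa [Nat.add_sub_cancel] at this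
  · have h1 := sum_update_sub hrf
    have h2 := h.sum_eq
    have h3 := choose_two_add r b
    rw [List.sum_append, sum_list_range]
    omega
  · intro i
    by_cases hi : i = j
    · subst hi
      rw [Function.update_self]
      -- In the used-up case the remainder is `(f i - b * m) + b²` for the old `m`, below `m + b² ≤
      -- 2n`.
      rcases hleft with hl | hl
      · left
        have : f i < b * r + 2 * n := by nlinarith
        omega
      · right
        have : b * (r + b) = b * r + b * b := by ring
        have : (r + b) * b = b * (r + b) := by ring
        have : Q + b * r ≤ f i := by nlinarith
        omega
    · simpa [hi] using h.lt_or_le i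
  · have := h.le_start; omega
  · omega
  · intro w hw
    rcases List.mem_append.1 hw with hw | hw
    · exact h.mem_le w hw
    · have := List.mem_range.1 hw
      exact this.le.trans ((Nat.le_div_iff_mul_le hM).2 hbM)
  · intro s hs
    have h1 := h.many s hs
    rw [List.filter_append, List.sum_append, sum_filter_lt_range (hs.trans hbn)]
    -- A block lowers `m²` by at most `2bm ≤ 4Q`, and since `s ≤ Q / n ≤ b` it contains all stars
    -- below `s`.
    have h2 : (r + b) ^ 2 ≤ 4 * Q + r ^ 2 := by nlinarith
    nlinarith [Nat.mul_le_mul_right (s.choose 2) h2]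
  · have h1 := h.large
    have h2 := log_sub_log_sub_le (Q := Q) (m := (r + b : ℕ)) (b := b) (by exact_mod_cast hm)
      (by exact_mod_cast hb2') (by exact_mod_cast (by omega : 2 * b ≤ r + b)) (by positivity)
      (by exact_mod_cast hb1.le)
    rw [List.sum_append, sum_list_range]
    push_cast [Nat.cast_choose_two] at h1 h2 ⊢
    rw [add_sub_cancel_right] at h2
    linarith

lemma BlockState.exists_lt_two_mul {n : ℕ} {e : K → ℕ} {Q M m₀ : ℕ} (hm₀ : m₀ ≤ n) (hn : 0 < n)
    (hM : 0 < M) (hnQ : 2 * n ≤ Q) (hk : Fintype.card K * (2 * n) < (2 * M).choose 2)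
    (hQn : Q ^ 2 ≤ n * M ^ 2) (hQM : Q ≤ M ^ 2) (m : ℕ) :
    ∀ {f : K → ℕ} {W : List ℕ}, BlockState n e Q M m₀ m f W →
      ∃ m' f' W', m' < 2 * M ∧ BlockState n e Q M m₀ m' f' W' := by
  induction m using Nat.strong_induction_on with
  | _ m ih =>
    intro f W h
    by_cases hm : 2 * M ≤ m
    · obtain ⟨b, f', W', hb, hbm, h'⟩ := h.step hm₀ hm hn hM hnQ hk hQn hQM
      exact ih (m - b) (by omega) h'
    · exact ⟨m, f, W, by omega, h⟩

lemma BlockState.distributes {n : ℕ} {e : K → ℕ} {Q M m₀ m : ℕ} {f : K → ℕ} {W : List ℕ}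
    (h : BlockState n e Q M m₀ m f W) (hm : m < 2 * M) (hQ : 0 < Q)
    (hmany : 4 * Q * Fintype.card K + 4 * M ^ 2 ≤ m₀ ^ 2)
    (hdiv : Q / M ≤ (Q / n).choose 2) (hQk : Q / M ≤ 2 * Fintype.card K)
    (hM : 0 < M)
    (hlarge : 32 * (Fintype.card K : ℝ) ^ 2 ≤ Q * (Real.log m₀ - Real.log (2 * M))) :
    Distributes (W ++ List.range m) f := by
  set k := Fintype.card K with hkdef
  have hsmall : ∀ s ≤ Q / n, k * s.choose 2 ≤ (W.filter (· < s)).sum := by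
    intro s hs
    have h1 := h.many s hs
    have h2 : m ^ 2 ≤ 4 * M ^ 2 := by nlinarith
    have h3 := Nat.mul_le_mul_right (s.choose 2) (le_trans (Nat.add_le_add_left h2 _) hmany)
    have h4 : 4 * Q * (k * s.choose 2) ≤ 4 * Q * (W.filter (· < s)).sum := by nlinarith
    exact Nat.le_of_mul_le_mul_left h4 (by positivity)
  have hchoose : ∀ s : ℕ, 1 ≤ s → s - 1 ≤ s.choose 2 := by
    intro s hs
    obtain ⟨t, rfl⟩ : ∃ t, s = t + 1 := ⟨s - 1, by omega⟩
    rw [Nat.choose_succ_succ' t 1]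
    simp
  have hW : 2 * k ^ 2 ≤ W.sum := by
    have h1 := h.large
    have hm0 : 0 < m := by have := h.le_end; omega
    have h2 : Real.log m ≤ Real.log (2 * M) :=
      Real.log_le_log (by exact_mod_cast hm0) (by exact_mod_cast hm.le)
    have h3 : (Q : ℝ) * (Real.log m₀ - Real.log (2 * M)) ≤ Q * (Real.log m₀ - Real.log m) := by
      gcongr
    have : (32 * k ^ 2 : ℝ) ≤ 16 * W.sum := by linarith
    have : 32 * k ^ 2 ≤ 16 * W.sum := by exact_mod_cast this
    omega
  refine distributes_of_forall_lt ?_ fun s hs hs1 => ?_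
  · rw [List.sum_append, sum_list_range, h.sum_eq]
  · rw [List.filter_append, List.sum_append, ← hkdef]
    -- Four ranges of `s`: up to `Q / n` every block helps; up to `Q / M` the sum already reached at
    -- `Q / n` suffices; up to `2k` all of `W` is smaller than `s` and has sum at least `2k²`;
    -- beyond that the stars of the final `K_m` suffice.
    by_cases c1 : s ≤ Q / n
    · have := (Nat.mul_le_mul_left k (hchoose s hs1)).trans (hsmall s c1)
      omega
    by_cases c2 : s ≤ Q / M
    · have h1 := hsmall _ le_rfl
      have h2 := sum_filter_lt_mono W (Nat.le_of_not_le c1)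
      have h3 : k * (s - 1) ≤ k * (Q / n).choose 2 := Nat.mul_le_mul_left k (by omega)
      omega
    by_cases c3 : s ≤ 2 * k
    · have h1 : (W.filter (· < s)).sum = W.sum := by
        rw [List.filter_eq_self.2]
        intro w hw
        have := h.mem_le w hw
        simp; omega
      have : k * (s - 1) ≤ k * (2 * k) := Nat.mul_le_mul_left k (by omega)
      have : k * (2 * k) = 2 * k ^ 2 := by ring
      omega
    · have hsm : s < m := by
        rcases List.mem_append.1 hs with hs | hs
        · have := (h.mem_le s hs).trans hQk
          omega
        · exact List.mem_range.1 hs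
      rw [sum_filter_lt_range hsm.le]
      have h1 : k * (s - 1) ≤ s.choose 2 := by
        rw [Nat.choose_two_right, Nat.le_div_iff_mul_le two_pos]
        nlinarith [Nat.mul_le_mul_right (s - 1) (Nat.le_of_not_le c3)]
      omega

end Reduction

/-! ### Choice of the parameters -/

/-- The numerical conditions under which all colour distributions on `n` vertices are realized. -/
lemma realizable_of_sum_eq {K : Type*} [Fintype K] [Nonempty K] {n Q M : ℕ}
    {e : K → ℕ} (he : ∑ i, e i = n.choose 2) (hM : 0 < M)
    (hkQ : 64 * (Fintype.card K * Q) ≤ n ^ 2) (hn : 2 ≤ n)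
    (hnQ : 2 * n ≤ Q) (hk : Fintype.card K * (2 * n) < (2 * M).choose 2)
    (hQn : Q ^ 2 ≤ n * M ^ 2) (hQM : Q ≤ M ^ 2)
    (hmany : 16 * (Fintype.card K * Q) + 16 * M ^ 2 ≤ n ^ 2)
    (hdiv : Q / M ≤ (Q / n).choose 2) (hQk : Q / M ≤ 2 * Fintype.card K)
    (hlarge : 32 * (Fintype.card K : ℝ) ^ 2 ≤ Q * Real.log (n / (4 * M))) :
    Realizable n e := by
  classical
  obtain ⟨m₀, hm₀, f, hr, hs, hf, hsum⟩ :=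
    Reduces.exists_forall_lt_or_le (n := n) (by omega) Q le_rfl (Reduces.refl n e) he
  have hbig := sum_le_sum_ite_add e Q
  -- The colours with at least `Q` edges lost nothing, and the others have at most `kQ ≤ n²/64`
  -- edges in all.
  have hm₀n : n ≤ 2 * m₀ := by
    by_contra! hcon
    have h1 : n.choose 2 ≤ m₀.choose 2 + Fintype.card K * Q := by omega
    have h2 : (n.choose 2 : ℝ) ≤ m₀.choose 2 + Fintype.card K * Q := by exact_mod_cast h1
    have h3 : (64 : ℝ) * (Fintype.card K * Q) ≤ n ^ 2 := by exact_mod_cast hkQ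
    have h4 : (2 : ℝ) * m₀ ≤ n := by exact_mod_cast hcon.le
    have h5 : (2 : ℝ) ≤ n := by exact_mod_cast hn
    rw [Nat.cast_choose_two, Nat.cast_choose_two] at h2
    have h6 : (0 : ℝ) ≤ m₀ := by positivity
    nlinarith
  have hmM : 2 * M ≤ m₀ := by
    have h1 : 16 * M ^ 2 ≤ n ^ 2 := by omega
    have h2 : (4 * M) ^ 2 ≤ n ^ 2 := by nlinarith
    have := (Nat.pow_le_pow_iff_left two_ne_zero).1 h2
    omega
  have hstart : BlockState n e Q M m₀ m₀ f [] := by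
    refine ⟨hr, by simpa using hs, fun i => ?_, le_rfl, by omega, by simp, by simp, by simp⟩
    rcases hf i with h | h
    exacts [.inl (by omega), .inr h]
  obtain ⟨m, f', W, hm, h⟩ :=
    BlockState.exists_lt_two_mul hm₀ (by omega) hM hnQ hk hQn hQM m₀ hstart
  refine h.reduces.realizable (h.distributes hm (by omega) ?_ hdiv hQk hM ?_)
  · nlinarith
  · refine hlarge.trans (mul_le_mul_of_nonneg_left ?_ (by positivity))
    have h1 : (0 : ℝ) < M := by exact_mod_cast hM
    have h2 : (0 : ℝ) < m₀ := by exact_mod_cast (by omega : 0 < m₀)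
    have h3 : (n : ℝ) ≤ 2 * m₀ := by exact_mod_cast hm₀n
    have h4 : (0 : ℝ) < n := by exact_mod_cast (by omega : 0 < n)
    rw [← Real.log_div h2.ne' (by positivity)]
    refine Real.log_le_log (by positivity) ?_
    rw [div_le_div_iff₀ (by positivity) (by positivity)]
    nlinarith

set_option maxHeartbeats 800000 in
/-- The numerical conditions in terms of a single real parameter `t`. -/
lemma realizable_of_bounds {K : Type*} [Fintype K] [Nonempty K] {n : ℕ} {t : ℝ} {e : K → ℕ}
    (he : ∑ i, e i = n.choose 2) (ht : 64 ≤ t)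
    (hlow : 1024 * (Fintype.card K * t ^ 2) ≤ n)
    (hupp : n * t ^ 2 ≤ 128 * (Fintype.card K : ℝ) ^ 2)
    (hlog : 4096 * (Fintype.card K : ℝ) ^ 3 ≤ n ^ 2 * Real.log (t / 8)) :
    Realizable n e := by
  set k := Fintype.card K with hk
  have hk0 : 0 < k := Fintype.card_pos
  have hk1 : (1 : ℝ) ≤ k := by exact_mod_cast hk0
  have ht0 : (0 : ℝ) < t := by linarith
  have ht2 : 64 * t ≤ t ^ 2 := by nlinarith
  have hnk : (2 ^ 22 : ℝ) * k ≤ n := by nlinarith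
  have hnkt : 1024 * 64 * (k * t) ≤ (n : ℝ) := by nlinarith
  have hn0 : (0 : ℝ) < n := by linarith
  have htk : 8 * (t ^ 2 * t ^ 2) ≤ (k : ℝ) := by
    have h1 : 1024 * (k * t ^ 2) * t ^ 2 ≤ 128 * (k : ℝ) ^ 2 :=
      (mul_le_mul_of_nonneg_right hlow (by positivity)).trans hupp
    have h2 : (k : ℝ) * (8 * (t ^ 2 * t ^ 2)) ≤ k * k := by nlinarith
    exact le_of_mul_le_mul_left h2 (by linarith)
  -- The vertex number shrinks from at least `n/2` to below `2M`, a gain of at least `log (t / 8)`.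
  -- `Q` is of the order of an average colour class, with `kQ ≤ n²/64`.
  set M := ⌈n / t⌉₊ with hM
  set Q := n ^ 2 / (64 * k) with hQ
  have hMl : n / t ≤ M := Nat.le_ceil _
  have hnt : 1 ≤ n / t := by rw [le_div_iff₀ ht0]; nlinarith
  have hMu : (M : ℝ) ≤ 2 * (n / t) := by
    have := Nat.ceil_lt_add_one (a := n / t) (by positivity)
    linarith
  have hMl' : n ≤ M * t := by rwa [div_le_iff₀ ht0] at hMl
  have hMu' : M * t ≤ 2 * (n : ℝ) := by
    rw [← mul_div_assoc, le_div_iff₀ ht0] at hMu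
    exact hMu
  have hM1 : (1 : ℝ) ≤ M := hnt.trans hMl
  have hM0 : 0 < M := by exact_mod_cast hM1
  have hQu : Q * (64 * k) ≤ n ^ 2 := Nat.div_mul_le_self _ _
  have hQu' : (Q : ℝ) * (64 * k) ≤ n ^ 2 := by exact_mod_cast hQu
  have hQl : (n : ℝ) ^ 2 ≤ (Q + 1) * (64 * k) := by
    have := Nat.lt_mul_div_succ (n ^ 2) (b := 64 * k) (by omega)
    rw [← hQ, mul_comm] at this
    exact_mod_cast this.le
  have hQl' : (n : ℝ) ^ 2 ≤ Q * (128 * k) := by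
    have h1 : (2 ^ 22 * k) * (2 ^ 22 * k) ≤ (n : ℝ) * n := by gcongr
    nlinarith
  have hMM : (n : ℝ) ^ 2 ≤ M ^ 2 * t ^ 2 := by
    rw [← mul_pow]
    exact pow_le_pow_left₀ hn0.le hMl' 2
  have hQn : (128 * k : ℝ) * (2 * n) ≤ (128 * k) * Q := by nlinarith
  have hQn' : 2 * n ≤ Q := by
    have : (2 * n : ℝ) ≤ Q := le_of_mul_le_mul_left hQn (by positivity)
    exact_mod_cast this
  have hnpos : 0 < n := by exact_mod_cast hn0
  have hQM : ((Q / M : ℕ) : ℝ) ≤ n * t / (64 * k) := by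
    refine Nat.cast_div_le.trans ?_
    rw [div_le_div_iff₀ (by positivity) (by positivity)]
    calc (Q : ℝ) * (64 * k) ≤ n * n := by rw [← sq]; exact hQu'
      _ ≤ n * (M * t) := by gcongr
      _ = n * t * M := by ring
  refine realizable_of_sum_eq (Q := Q) (M := M) he hM0 ?_ ?_ hQn' ?_ ?_ ?_ ?_ ?_ ?_ ?_
  · rw [← hk]; nlinarith
  · have : (2 : ℝ) ≤ n := by linarith
    exact_mod_cast this
  · have h1 : (k : ℝ) * (2 * n) < M ^ 2 := by
      have h2 : (k : ℝ) * (2 * n) * t ^ 2 < M ^ 2 * t ^ 2 := by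
        refine lt_of_lt_of_le ?_ hMM
        nlinarith
      exact lt_of_mul_lt_mul_right h2 (by positivity)
    have h2 : k * (2 * n) < M ^ 2 := by exact_mod_cast h1
    refine h2.trans_le ?_
    rw [Nat.choose_two_right, Nat.le_div_iff_mul_le two_pos]
    obtain ⟨r, hr⟩ : ∃ r, M = r + 1 := ⟨M - 1, by omega⟩
    rw [hr, show 2 * (r + 1) - 1 = 2 * r + 1 by omega]
    nlinarith
  · have h1 : (Q : ℝ) ^ 2 * (64 * k) ^ 2 ≤ n * M ^ 2 * (64 * k) ^ 2 := by
      calc (Q : ℝ) ^ 2 * (64 * k) ^ 2 = (Q * (64 * k)) ^ 2 := by ring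
        _ ≤ ((n : ℝ) ^ 2) ^ 2 := by gcongr
        _ = (n : ℝ) ^ 2 * n ^ 2 := by ring
        _ ≤ (n : ℝ) ^ 2 * (M ^ 2 * t ^ 2) := by gcongr
        _ = (n * (M : ℝ) ^ 2) * (n * t ^ 2) := by ring
        _ ≤ (n * M ^ 2) * (64 * k) ^ 2 := by gcongr; nlinarith
    have h2 : (Q : ℝ) ^ 2 ≤ n * M ^ 2 := le_of_mul_le_mul_right h1 (by positivity)
    exact_mod_cast h2
  · have h1 : (Q : ℝ) * (64 * k) ≤ M ^ 2 * (64 * k) := by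
      refine (hQu'.trans hMM).trans ?_
      gcongr
      nlinarith
    have h2 : (Q : ℝ) ≤ M ^ 2 := le_of_mul_le_mul_right h1 (by positivity)
    exact_mod_cast h2
  · have h1 : (M : ℝ) * 64 ≤ M * t := by gcongr
    have h2 : (M : ℝ) * 32 ≤ n := by linarith
    have h3 : 32 * M ≤ n := by exact_mod_cast (by linarith : 32 * (M : ℝ) ≤ n)
    have h4 := Nat.mul_le_mul h3 h3
    rw [← hk]
    nlinarith
  · set q := Q / n with hq
    have h3 : (Q : ℝ) ≤ n * (q + 1) := by
      exact_mod_cast (Nat.lt_mul_div_succ Q hnpos).le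
    have h4 : (n : ℝ) ≤ (q + 1) * (128 * k) := by
      have : (n : ℝ) * n ≤ n * ((q + 1) * (128 * k)) := by
        calc (n : ℝ) * n = n ^ 2 := by ring
          _ ≤ Q * (128 * k) := hQl'
          _ ≤ n * (q + 1) * (128 * k) := by gcongr
          _ = _ := by ring
      exact le_of_mul_le_mul_left this hn0
    have h5 : (2 ^ 15 : ℝ) ≤ q + 1 := by
      have : (2 ^ 15 : ℝ) * (128 * k) ≤ (q + 1) * (128 * k) := by linarith
      exact le_of_mul_le_mul_right this (by positivity)
    have h6 : (n : ℝ) ≤ q * (256 * k) := by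
      calc (n : ℝ) ≤ (q + 1) * (128 * k) := h4
        _ ≤ (2 * q) * (128 * k) := by gcongr; linarith
        _ = _ := by ring
    have h7 : n * t / (64 * k) ≤ ((q.choose 2 : ℕ) : ℝ) := by
      rw [Nat.cast_choose_two, div_le_iff₀ (by positivity)]
      have h8 : t * 256 ≤ q := by
        have : (t * 256) * (256 * k) ≤ q * (256 * k) := by linarith
        exact le_of_mul_le_mul_right this (by positivity)
      calc (n : ℝ) * t ≤ q * (256 * k) * (q / 256) := by
            gcongr
            linarith
        _ = (q * q) * k := by ring
        _ ≤ (q * (q - 1) * 32) * k :=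
            mul_le_mul_of_nonneg_right (by nlinarith) (by positivity)
        _ = _ := by ring
    exact_mod_cast hQM.trans h7
  · have h3 : n * t / (64 * k) ≤ 2 * (k : ℝ) := by
      rw [div_le_iff₀ (by positivity)]
      nlinarith
    rw [← hk]
    exact_mod_cast hQM.trans h3
  · have h1 : t / 8 ≤ n / (4 * M) := by
      rw [div_le_div_iff₀ (by positivity) (by positivity)]
      linarith
    have h2 : Real.log (t / 8) ≤ Real.log (n / (4 * M)) :=
      Real.log_le_log (by positivity) h1
    have h3 : 0 ≤ Real.log (t / 8) := Real.log_nonneg (by linarith)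
    refine le_trans ?_ (mul_le_mul_of_nonneg_left h2 (by positivity))
    have h4 : 32 * (k : ℝ) ^ 2 * (128 * k) ≤ Q * Real.log (t / 8) * (128 * k) := by
      calc 32 * (k : ℝ) ^ 2 * (128 * k) = 4096 * (k : ℝ) ^ 3 := by ring
        _ ≤ n ^ 2 * Real.log (t / 8) := hlog
        _ ≤ Q * (128 * k) * Real.log (t / 8) := by gcongr
        _ = _ := by ring
    exact le_of_mul_le_mul_right h4 (by positivity)

/-! ### Monotonicity in `n` and in `k` -/

/-- If all colour distributions are realizable on `n ≥ 2k` vertices, then so they are on `n + 1`: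
split off a star in the most frequent colour. -/
lemma realizable_succ {K : Type*} [Fintype K] [Nonempty K] {n : ℕ} (hn : 2 * Fintype.card K ≤ n)
    (h : ∀ e : K → ℕ, ∑ i, e i = n.choose 2 → Realizable n e) (e : K → ℕ)
    (he : ∑ i, e i = (n + 1).choose 2) : Realizable (n + 1) e := by
  classical
  have hc : (n + 1).choose 2 = n + n.choose 2 := by
    rw [Nat.choose_succ_succ' n 1, Nat.choose_one_right]
  obtain ⟨j, hj⟩ : ∃ j, n ≤ e j := by
    by_contra! hcon
    have h1 : ∑ i, e i ≤ Fintype.card K * (n - 1) := by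
      calc ∑ i, e i ≤ ∑ _i : K, (n - 1) :=
            Finset.sum_le_sum fun i _ => Nat.le_sub_one_of_lt (hcon i)
        _ = _ := by simp
    have h2 : 2 * (Fintype.card K * (n - 1)) ≤ n * (n - 1) := by
      rw [← mul_assoc]; exact Nat.mul_le_mul_right _ hn
    have h3 : n.choose 2 * 2 = n * (n - 1) := by
      rw [Nat.choose_two_right, Nat.div_two_mul_two_of_even (Nat.even_mul_pred_self n)]
    have : 0 < Fintype.card K := Fintype.card_pos
    omega
  have hr := Reduces.star (Reduces.refl (n + 1) e) hj
  exact hr _ 0 (add_zero _).symm (h _ (by have := sum_update_sub hj; omega)) rfl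

lemma allDistributionsGallaiFrom_of_realizable {k n : ℕ} (hk : 1 ≤ k) (hn : 2 * k ≤ n)
    (h : ∀ e : Fin k → ℕ, ∑ i, e i = n.choose 2 → Realizable n e) :
    AllDistributionsGallaiFrom k n := by
  have : Nonempty (Fin k) := ⟨⟨0, hk⟩⟩
  intro m hm
  have key : ∀ e : Fin k → ℕ, ∑ i, e i = m.choose 2 → Realizable m e := by
    induction m, hm using Nat.le_induction with
    | base => exact h
    | succ m hm ih => exact realizable_succ (by simpa using hn.trans hm) ih
  intro e he
  exact (exists_gallaiColouring_iff_realizable m e).2 (key e he)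

/-- Pad with colours that have no edges. This passes finiteness of the threshold from large `k'`
down to every `k`. -/
lemma AllDistributionsGallaiFrom.mono {k k' N : ℕ} (hk : 1 ≤ k) (hkk : k ≤ k')
    (h : AllDistributionsGallaiFrom k' N) : AllDistributionsGallaiFrom k N := by
  classical
  have : Nonempty (Fin k) := ⟨⟨0, hk⟩⟩
  have : Nonempty (Fin k') := ⟨⟨0, by omega⟩⟩
  intro n hn e he
  rw [exists_gallaiColouring_iff_realizable]
  have hinj := Fin.castLE_injective hkk
  let e' : Fin k' → ℕ := Function.extend (Fin.castLE hkk) e 0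
  have he' : ∑ i, e' i = n.choose 2 := by
    rw [← he]
    refine (Fintype.sum_of_injective (Fin.castLE hkk) hinj e e' (fun i hi => ?_)
      fun i => ?_).symm
    · exact Function.extend_apply' _ _ _ hi
    · exact (hinj.extend_apply e 0 i).symm
  obtain ⟨c, hc, hce⟩ := (exists_gallaiColouring_iff_realizable n e').1 (h n hn e' he')
  -- The values of `r` off the image of `Fin.castLE` are irrelevant, as those colours do not occur.
  let r : Fin k' → Fin k := Function.invFun (Fin.castLE hkk)
  refine ⟨fun x y => r (c x y), ⟨fun x y => by rw [hc.symm], fun x y z h1 h2 h3 => ?_⟩,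
    fun i => ?_⟩
  · rcases hc.tri x y z h1 h2 h3 with h | h | h
    exacts [.inl (congrArg r h), .inr (.inl (congrArg r h)), .inr (.inr (congrArg r h))]
  · have h1 := hce (Fin.castLE hkk i)
    rw [show e' (Fin.castLE hkk i) = e i from hinj.extend_apply e 0 i] at h1
    rw [← h1]
    congr 1
    ext ⟨x, y⟩
    simp only [colourPairs, Finset.mem_filter, Finset.mem_univ, true_and, Set.mem_singleton_iff]
    refine and_congr_right fun hxy => ⟨fun hr => ?_, fun hr => ?_⟩
    · by_cases hex : ∃ a, Fin.castLE hkk a = c x y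
      · rw [← hr]
        exact (Function.invFun_eq hex).symm
      · have h2 := hce (c x y)
        rw [show e' (c x y) = 0 from Function.extend_apply' _ _ _ hex, mul_zero,
          Finset.card_eq_zero] at h2
        have : (x, y) ∈ colourPairs c {c x y} := by simp [colourPairs, hxy]
        simp [h2] at this
    · rw [hr]
      exact Function.leftInverse_invFun hinj i

/-! ### Connected colours in Gallai colourings -/

namespace IsGallaiMap

variable {V K : Type*} {c : V → V → K}

/-- The graph formed by the edges with colours in `I`. -/
def graph (hc : IsGallaiMap c) (I : Set K) : SimpleGraph V where
  Adj x y := x ≠ y ∧ c x y ∈ I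
  symm := ⟨fun x y h => ⟨h.1.symm, hc.symm x y ▸ h.2⟩⟩
  loopless := ⟨fun _ h => h.1 rfl⟩

/-- A vertex outside a component of the graph of `I` sends edges of a single colour to it. -/
lemma eq_of_reachable (hc : IsGallaiMap c) {I : Set K} {a a' b : V}
    (h : (hc.graph I).Reachable a a') (hb : ¬ (hc.graph I).Reachable a b) : c a b = c a' b := by
  obtain ⟨p⟩ := h
  induction p with
  | nil => rfl
  | @cons u v w huv p ih =>
    have hvb : ¬ (hc.graph I).Reachable v b := fun h => hb (huv.reachable.trans h)
    rw [← ih hvb]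
    have h1 : u ≠ b := fun h => hb (h ▸ SimpleGraph.Reachable.refl _)
    have h2 : v ≠ b := fun h => hvb (h ▸ SimpleGraph.Reachable.refl _)
    have h3 : c u b ∉ I := fun h => hb (SimpleGraph.Adj.reachable ⟨h1, h⟩)
    have h4 : c v b ∉ I := fun h => hvb (SimpleGraph.Adj.reachable ⟨h2, h⟩)
    rcases hc.tri u v b huv.1 h2 h1 with h | h | h
    · exact absurd (h ▸ huv.2) h4
    · exact h.symm
    · exact absurd (h ▸ huv.2) h3

end IsGallaiMap

lemma SimpleGraph.Preconnected.exists_adj_mem_notMem {V : Type*} {G : SimpleGraph V}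
    (h : G.Preconnected) {T : Set V} {x y : V} (hx : x ∈ T) (hy : y ∉ T) :
    ∃ a ∈ T, ∃ b ∉ T, G.Adj a b := by
  obtain ⟨p⟩ := h x y
  obtain ⟨d, -, h1, h2⟩ := p.exists_boundary_dart T hx hy
  exact ⟨_, h1, _, h2, d.adj⟩

namespace IsGallaiMap

section

variable {V K : Type*} {c : V → V → K}

/-- Some edge leaves each component of `I`, and its colour lies in `J`. Its outer end sees the whole
component in that same colour, so the component lies inside one component of `J`. -/
lemma preconnected_of_union (hc : IsGallaiMap c) {I J : Set K}
    (hI : ¬ (hc.graph I).Preconnected) (hIJ : (hc.graph (I ∪ J)).Preconnected) :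
    (hc.graph J).Preconnected := by
  have hA : ∀ a, ∃ b, ¬ (hc.graph I).Reachable a b ∧ c a b ∈ J := by
    intro a
    obtain ⟨y, hy⟩ : ∃ y, ¬ (hc.graph I).Reachable a y := by
      by_contra! hcon
      exact hI fun u v => (hcon u).symm.trans (hcon v)
    obtain ⟨u, hu, b, hb, hub⟩ :=
      hIJ.exists_adj_mem_notMem (T := {x | (hc.graph I).Reachable a x})
        (SimpleGraph.Reachable.refl a) hy
    have hu' : (hc.graph I).Reachable a u := hu
    have hb' : ¬ (hc.graph I).Reachable a b := hb
    refine ⟨b, hb', ?_⟩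
    rw [hc.eq_of_reachable hu' hb']
    rcases hub.2 with h | h
    · exact absurd (hu'.trans (SimpleGraph.Adj.reachable ⟨hub.1, h⟩)) hb'
    · exact h
  have hadj : ∀ {a b}, ¬ (hc.graph I).Reachable a b → c a b ∈ J → (hc.graph J).Reachable a b :=
    fun {a b} h1 h2 =>
      SimpleGraph.Adj.reachable ⟨fun h => h1 (h ▸ SimpleGraph.Reachable.refl _), h2⟩
  have hB : ∀ {a a'}, (hc.graph I).Reachable a a' → (hc.graph J).Reachable a a' := by
    intro a a' h
    obtain ⟨b, hb, hJ⟩ := hA a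
    have hb' : ¬ (hc.graph I).Reachable a' b := fun h' => hb (h.trans h')
    exact (hadj hb hJ).trans (hadj hb' (hc.eq_of_reachable h hb ▸ hJ)).symm
  intro x y
  obtain ⟨p⟩ := hIJ x y
  induction p with
  | nil => exact SimpleGraph.Reachable.refl _
  | @cons u v w huv p ih =>
    refine SimpleGraph.Reachable.trans ?_ ih
    rcases huv.2 with h | h
    · exact hB (SimpleGraph.Adj.reachable ⟨huv.1, h⟩)
    · exact SimpleGraph.Adj.reachable ⟨huv.1, h⟩

lemma not_preconnected_finset [Nontrivial V] (hc : IsGallaiMap c) (D : Finset K)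
    (hD : ∀ i ∈ D, ¬ (hc.graph {i}).Preconnected) :
    ¬ (hc.graph (D : Set K)).Preconnected := by
  classical
  induction D using Finset.induction_on with
  | empty =>
    intro h
    obtain ⟨x, y, hxy⟩ := exists_pair_ne V
    obtain ⟨a, -, b, -, hab⟩ := h.exists_adj_mem_notMem (T := {x}) rfl hxy.symm
    simpa using hab.2
  | insert i s _ ih =>
    intro h
    rw [Finset.coe_insert, ← Set.singleton_union] at h
    exact ih (fun j hj => hD j (Finset.mem_insert_of_mem hj))
      (hc.preconnected_of_union (hD i (Finset.mem_insert_self i s)) h)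

lemma restrict (hc : IsGallaiMap c) {W : Type*} (φ : W ↪ V) :
    IsGallaiMap fun x y => c (φ x) (φ y) :=
  ⟨fun _ _ => hc.symm _ _, fun _ _ _ h1 h2 h3 =>
    hc.tri _ _ _ (φ.injective.ne h1) (φ.injective.ne h2) (φ.injective.ne h3)⟩

lemma exists_colour_eq_of_preconnected [Nontrivial V] (hc : IsGallaiMap c) {i : K}
    (h : (hc.graph {i}).Preconnected) (v : V) : ∃ w, w ≠ v ∧ c v w = i := by
  obtain ⟨y, hy⟩ := exists_ne v
  obtain ⟨a, rfl, b, hb, hab⟩ := h.exists_adj_mem_notMem (T := {v}) rfl hy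
  exact ⟨b, hb, hab.2⟩

/-- If three colours span connected graphs, they still do so after deleting a vertex. -/
lemma preconnected_delete [Nontrivial V] (hc : IsGallaiMap c) {i j l : K} (hij : i ≠ j)
    (hil : i ≠ l) (hjl : j ≠ l) (hi : (hc.graph {i}).Preconnected)
    (hj : (hc.graph {j}).Preconnected) (hl : (hc.graph {l}).Preconnected) (v : V) :
    ((hc.restrict (Function.Embedding.subtype (· ≠ v))).graph {l}).Preconnected := by
  set hc' := hc.restrict (Function.Embedding.subtype (· ≠ v))
  by_contra hcon
  -- Colour `l` was connected before the deletion, so `v` sends an edge of colour `l` to each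
  -- `l`-component of the rest.
  have hN : ∀ x : {w // w ≠ v}, ∃ x', (hc'.graph {l}).Reachable x x' ∧ c v x' = l := by
    intro x
    obtain ⟨a, ⟨a', ha, rfl⟩, b, hb, hab⟩ := hl.exists_adj_mem_notMem
      (T := Subtype.val '' {x' | (hc'.graph {l}).Reachable x x'}) (x := x) (y := v)
      ⟨x, SimpleGraph.Reachable.refl x, rfl⟩ (by rintro ⟨a, -, h⟩; exact a.2 h)
    have hbv : b = v := by
      by_contra hbv
      refine hb ⟨⟨b, hbv⟩, ?_, rfl⟩
      refine SimpleGraph.Reachable.trans ha (SimpleGraph.Adj.reachable ⟨?_, hab.2⟩)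
      exact fun h => hab.1 (congrArg Subtype.val h)
    subst hbv
    exact ⟨a', ha, by rw [hc.symm]; exact hab.2⟩
  -- If `v w` has colour `i' ≠ l`, the triangle on `v`, `w` and an `l`-neighbour of `v` in another
  -- component forces colour `i'` from `w` to that component.
  have hP : ∀ {i' : K} {w y : {w // w ≠ v}}, i' ≠ l → c v w = i' →
      ¬ (hc'.graph {l}).Reachable w y → c w y = i' := by
    intro i' w y hi' hw hwy
    obtain ⟨y', hy', hvy⟩ := hN y
    have h1 : ¬ (hc'.graph {l}).Reachable y w := fun h => hwy h.symm
    have h2 : c y w = c y' w := hc'.eq_of_reachable hy' h1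
    have h3 : ¬ (hc'.graph {l}).Reachable w y' := fun h => hwy (h.trans hy'.symm)
    have h4 : w ≠ y' := fun h => h3 (h ▸ SimpleGraph.Reachable.refl _)
    have h5 : (w : V) ≠ y' := fun h => h4 (Subtype.ext h)
    have h6 : c w y' ≠ l := fun h => h3 (SimpleGraph.Adj.reachable ⟨h4, h⟩)
    rw [hc.symm, h2, hc.symm]
    rcases hc.tri v w y' w.2.symm h5 y'.2.symm with h | h | h
    · rw [← h, hw]
    · exact absurd (h.trans hvy) h6
    · exact absurd (hw ▸ h.trans hvy) hi'
  obtain ⟨w, hwv, hw⟩ := hc.exists_colour_eq_of_preconnected hi v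
  obtain ⟨z, hzv, hz⟩ := hc.exists_colour_eq_of_preconnected hj v
  -- In one component, `w` and `z` send the same colour to an outside vertex; in different ones, the
  -- edge `w z` gets both colours. Either way `i = j`.
  by_cases hwz : (hc'.graph {l}).Reachable ⟨w, hwv⟩ ⟨z, hzv⟩
  · obtain ⟨y, hy⟩ : ∃ y, ¬ (hc'.graph {l}).Reachable ⟨w, hwv⟩ y := by
      by_contra! h
      exact hcon fun a b => (h a).symm.trans (h b)
    have h1 : c w y = i := hP (w := ⟨w, hwv⟩) hil hw hy
    have h2 : c z y = j := hP (w := ⟨z, hzv⟩) hjl hz fun h => hy (hwz.trans h)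
    have h3 : c w y = c z y := hc'.eq_of_reachable hwz hy
    exact hij (h1.symm.trans (h3.trans h2))
  · have h1 : c w z = i := hP (w := ⟨w, hwv⟩) (y := ⟨z, hzv⟩) hil hw hwz
    have h2 : c z w = j := hP (w := ⟨z, hzv⟩) (y := ⟨w, hwv⟩) hjl hz fun h => hwz h.symm
    exact hij (h1.symm.trans ((hc.symm w z).trans h2))

end

/-- At most two colours of a Gallai colouring span connected graphs. -/
lemma not_three_preconnected {K : Type*} (n : ℕ) : ∀ {V : Type*} [Fintype V] [Nontrivial V]
    {c : V → V → K} (hc : IsGallaiMap c), Fintype.card V = n → ∀ {i j l : K}, i ≠ j → i ≠ l →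
      j ≠ l → (hc.graph {i}).Preconnected → (hc.graph {j}).Preconnected →
      (hc.graph {l}).Preconnected → False := by
  classical
  induction n with
  | zero =>
    intro V _ _ c hc hV
    have := Fintype.card_pos (α := V)
    omega
  | succ n ih =>
    intro V _ _ c hc hV i j l hij hil hjl hi hj hl
    obtain ⟨v⟩ : Nonempty V := inferInstance
    -- With two vertices there is a single edge, which cannot carry both `i` and `j`.
    obtain hs | hs := subsingleton_or_nontrivial {w : V // w ≠ v}
    · obtain ⟨w, hwv, hw⟩ := hc.exists_colour_eq_of_preconnected hi v
      obtain ⟨z, hzv, hz⟩ := hc.exists_colour_eq_of_preconnected hj v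
      have : w = z := congrArg Subtype.val (Subsingleton.elim (⟨w, hwv⟩ : {w // w ≠ v}) ⟨z, hzv⟩)
      exact hij (by rw [← hw, ← hz, this])
    · exact ih (hc.restrict (Function.Embedding.subtype (· ≠ v)))
        (by rw [Fintype.card_subtype_compl, Fintype.card_subtype_eq, hV, Nat.add_sub_cancel])
        hij hil hjl
        (hc.preconnected_delete hjl hij.symm hil.symm hj hl hi v)
        (hc.preconnected_delete hil hij hjl.symm hi hl hj v)
        (hc.preconnected_delete hij hil hjl hi hj hl v)

variable {V K : Type*} {c : V → V → K}

lemma two_mul_card_le_of_preconnected [Fintype V] [Nonempty V] (hc : IsGallaiMap c) {i : K}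
    (h : (hc.graph {i}).Preconnected) :
    2 * Fintype.card V ≤ (colourPairs c {i}).card + 2 := by
  classical
  have hconn : (hc.graph {i}).Connected := ⟨h⟩
  have h1 := hconn.card_vert_le_card_edgeSet_add_one
  have h2 := SimpleGraph.two_mul_card_edgeFinset (hc.graph {i})
  rw [Nat.card_eq_fintype_card, Nat.card_eq_fintype_card, ← SimpleGraph.edgeFinset_card] at h1
  have h3 : (Finset.univ.filter fun p : V × V => (hc.graph {i}).Adj p.1 p.2)
      = colourPairs c {i} := by
    ext ⟨x, y⟩
    simp [colourPairs, graph]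
  rw [← h3, ← h2]
  omega

/-- There is a cut whose edges have at most two colours, each of which spans a connected graph. -/
lemma exists_cut [Fintype V] [Nontrivial V] [Fintype K] (hc : IsGallaiMap c) :
    ∃ P : Set V, P.Nonempty ∧ Pᶜ.Nonempty ∧ ∃ s : Finset K, s.card ≤ 2 ∧
      (∀ i ∈ s, 2 * Fintype.card V ≤ (colourPairs c {i}).card + 2) ∧
      ∀ x ∈ P, ∀ y ∉ P, c x y ∈ s := by
  classical
  set D : Finset K := Finset.univ.filter fun i => ¬ (hc.graph {i}).Preconnected with hD
  have hnp := hc.not_preconnected_finset D (by simp [hD])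
  obtain ⟨a, b, hab⟩ : ∃ a b, ¬ (hc.graph (D : Set K)).Reachable a b := by
    by_contra! h
    exact hnp fun a b => h a b
  refine ⟨{x | (hc.graph (D : Set K)).Reachable a x}, ⟨a, SimpleGraph.Reachable.refl a⟩,
    ⟨b, hab⟩, Dᶜ, ?_, ?_, ?_⟩
  · by_contra! h
    obtain ⟨i, hi, j, hj, l, hl, hij, hil, hjl⟩ := Finset.two_lt_card.1 h
    simp only [hD, Finset.mem_compl, Finset.mem_filter, Finset.mem_univ, true_and,
      not_not] at hi hj hl
    exact hc.not_three_preconnected _ rfl hij hil hjl hi hj hl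
  · intro i hi
    refine hc.two_mul_card_le_of_preconnected ?_
    simpa [hD] using hi
  · intro x hx y hy
    rw [Finset.mem_compl]
    intro hmem
    have hxy : x ≠ y := fun h => hy (h ▸ hx)
    exact hy (SimpleGraph.Reachable.trans hx (SimpleGraph.Adj.reachable ⟨hxy, hmem⟩))

end IsGallaiMap

/-! ### Few edges in the rare colours -/

open scoped Classical in
/-- The ordered pairs of distinct vertices of `S` whose colour lies in `I`. -/
noncomputable def colourPairsIn {V K : Type*} (c : V → V → K) (S : Finset V) (I : Set K) :
    Finset (V × V) :=
  (S ×ˢ S).filter fun p => p.1 ≠ p.2 ∧ c p.1 p.2 ∈ I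

section

variable {V K : Type*} {c : V → V → K}

lemma card_colourPairs_subtype (c : V → V → K) (S : Finset V) (I : Set K) :
    (colourPairs (fun x y : {x // x ∈ S} => c x y) I).card = (colourPairsIn c S I).card := by
  classical
  rw [← Finset.card_map ((Function.Embedding.subtype (· ∈ S)).prodMap
    (Function.Embedding.subtype (· ∈ S)))]
  congr 1
  ext ⟨x, y⟩
  simp only [colourPairs, colourPairsIn, Finset.mem_map, Finset.mem_filter, Finset.mem_univ,
    true_and, Finset.mem_product, Prod.exists, Subtype.exists]
  constructor
  · rintro ⟨a, ha, b, hb, ⟨h1, h2⟩, h⟩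
    obtain ⟨rfl, rfl⟩ := Prod.mk.inj h
    exact ⟨⟨ha, hb⟩, fun h => h1 (Subtype.ext h), h2⟩
  · rintro ⟨⟨ha, hb⟩, h1, h2⟩
    exact ⟨x, ha, y, hb, ⟨fun h => h1 (congrArg Subtype.val h), h2⟩, rfl⟩

lemma IsGallaiMap.exists_cut_finset [Fintype K] [DecidableEq V] (hc : IsGallaiMap c)
    {S : Finset V} (hS : 2 ≤ S.card) :
    ∃ P ⊆ S, P.Nonempty ∧ (S \ P).Nonempty ∧ ∃ s : Finset K, s.card ≤ 2 ∧
      (∀ i ∈ s, 2 * S.card ≤ (colourPairsIn c S {i}).card + 2) ∧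
      ∀ x ∈ P, ∀ y ∈ S \ P, c x y ∈ s := by
  classical
  have : Nontrivial {x // x ∈ S} := by
    rw [← Fintype.one_lt_card_iff_nontrivial, Fintype.card_coe]
    omega
  obtain ⟨P, ⟨a, ha⟩, ⟨b, hb⟩, s, hs, hcard, hcut⟩ :=
    (hc.restrict (Function.Embedding.subtype (· ∈ S))).exists_cut
  have hmem : ∀ x, x ∈ (P.toFinset.map (Function.Embedding.subtype (· ∈ S))) ↔
      ∃ h : x ∈ S, (⟨x, h⟩ : {x // x ∈ S}) ∈ P := by
    intro x; simp
  refine ⟨P.toFinset.map (Function.Embedding.subtype _), ?_, ⟨a, ?_⟩, ⟨b, ?_⟩, s, hs, ?_, ?_⟩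
  · intro x hx
    exact ((hmem x).1 hx).1
  · exact (hmem a).2 ⟨a.2, ha⟩
  · exact Finset.mem_sdiff.2 ⟨b.2, fun h => hb ((hmem b).1 h).2⟩
  · intro i hi
    have := hcard i hi
    rw [Fintype.card_coe] at this
    rw [← card_colourPairs_subtype]
    exact this
  · intro x hx y hy
    obtain ⟨hxS, hxP⟩ := (hmem x).1 hx
    obtain ⟨hyS, hyP⟩ := Finset.mem_sdiff.1 hy
    exact hcut ⟨x, hxS⟩ hxP ⟨y, hyS⟩ fun h => hyP ((hmem y).2 ⟨hyS, h⟩)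

lemma card_colourPairsIn_le (c : V → V → K) (S : Finset V) (I : Set K) :
    (colourPairsIn c S I).card ≤ S.card * (S.card - 1) := by
  classical
  calc (colourPairsIn c S I).card ≤ S.offDiag.card := by
        refine Finset.card_le_card fun p hp => ?_
        simp only [colourPairsIn, Finset.mem_filter, Finset.mem_product] at hp
        exact Finset.mem_offDiag.2 ⟨hp.1.1, hp.1.2, hp.2.1⟩
    _ = _ := by rw [Finset.offDiag_card, Nat.mul_sub_one]

lemma card_colourPairsIn_of_cut [DecidableEq V] (hc : IsGallaiMap c) {S P : Finset V} {I : Set K}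
    (hcut : ∀ x ∈ P, ∀ y ∈ S \ P, c x y ∉ I) :
    (colourPairsIn c S I).card ≤
      (colourPairsIn c P I).card + (colourPairsIn c (S \ P) I).card := by
  classical
  refine le_trans (Finset.card_le_card ?_) (Finset.card_union_le _ _)
  rintro ⟨x, y⟩ hp
  simp only [colourPairsIn, Finset.mem_filter, Finset.mem_product, Finset.mem_union,
    Finset.mem_sdiff] at hp hcut ⊢
  obtain ⟨⟨hx, hy⟩, hxy, hI⟩ := hp
  by_cases hxP : x ∈ P <;> by_cases hyP : y ∈ P
  · exact .inl ⟨⟨hxP, hyP⟩, hxy, hI⟩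
  · exact absurd hI (hcut x hxP y ⟨hy, hyP⟩)
  · exact absurd (hc.symm x y ▸ hI) (hcut y hyP x ⟨hx, hxP⟩)
  · exact .inr ⟨⟨⟨hx, hxP⟩, hy, hyP⟩, hxy, hI⟩

/-- Colours outside `I` have at most `E` edges and colours in `I` have at most `x` edges; then
there are few edges with colours in `I`. -/
lemma IsGallaiMap.card_colourPairsIn_le [Fintype V] [Fintype K] (hc : IsGallaiMap c) {I : Set K}
    {x E : ℕ} (hI : ∀ i ∈ I, (colourPairs c {i}).card ≤ 2 * x)
    (hE : ∀ i ∉ I, (colourPairs c {i}).card ≤ 2 * E) (S : Finset V) (hS : S.Nonempty) :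
    ((colourPairsIn c S I).card : ℝ) ≤ (x + 1) * x + 8 * E * Real.log S.card := by
  classical
  induction S using Finset.strongInduction with
  | H S ih =>
  have hlog : 0 ≤ Real.log S.card := Real.log_natCast_nonneg _
  by_cases hx : S.card ≤ x + 1
  · have h1 : (colourPairsIn c S I).card ≤ (x + 1) * x :=
      (_root_.card_colourPairsIn_le c S I).trans (Nat.mul_le_mul hx (by omega))
    have h2 : ((colourPairsIn c S I).card : ℝ) ≤ (x + 1) * x := by exact_mod_cast h1
    have : 0 ≤ 8 * E * Real.log S.card := by positivity
    linarith
  have hS0 := hS.card_pos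
  have hx0 : 2 ≤ S.card := by omega
  obtain ⟨P, hPS, hP, hP', s, hs, hcard, hcut⟩ := hc.exists_cut_finset hx0
  have hsub : ∀ i, (colourPairsIn c S {i}).card ≤ (colourPairs c {i}).card := fun i =>
    Finset.card_le_card fun p hp => by
      simp only [colourPairsIn, colourPairs, Finset.mem_filter, Finset.mem_univ, true_and] at hp ⊢
      exact hp.2
  -- A cut colour has at least `2|S| - 2 ≥ 2x + 2` ordered pairs, too many for a colour in `I`.
  have hsI : ∀ i ∈ s, i ∉ I := by
    intro i hi hiI
    have := hcard i hi
    have := hsub i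
    have := hI i hiI
    omega
  have hprod : P.card * (S \ P).card ≤ 4 * E := by
    calc P.card * (S \ P).card = (P ×ˢ (S \ P)).card := (Finset.card_product _ _).symm
      _ ≤ (s.biUnion fun i => colourPairs c {i}).card := by
          refine Finset.card_le_card ?_
          rintro ⟨a, b⟩ hab
          obtain ⟨ha, hb⟩ := Finset.mem_product.1 hab
          simp only [Finset.mem_biUnion, colourPairs, Finset.mem_filter, Finset.mem_univ,
            true_and]
          refine ⟨c a b, hcut a ha b hb, ?_, rfl⟩
          rintro rfl
          exact (Finset.mem_sdiff.1 hb).2 ha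
      _ ≤ ∑ i ∈ s, (colourPairs c {i}).card := Finset.card_biUnion_le
      _ ≤ ∑ _i ∈ s, 2 * E := Finset.sum_le_sum fun i hi => hE i (hsI i hi)
      _ = s.card * (2 * E) := by simp
      _ ≤ 2 * (2 * E) := Nat.mul_le_mul_right _ hs
      _ = 4 * E := by ring
  have hsplit := card_colourPairsIn_of_cut hc (I := I) fun a ha b hb =>
    hsI _ (hcut a ha b hb)
  have hadd : P.card + (S \ P).card = S.card := by
    rw [add_comm]; exact Finset.card_sdiff_add_card_eq_card hPS
  obtain ⟨R, T, hT, hTS, hRT, hRT', hprod', hle, hR⟩ : ∃ R T : Finset V, T.Nonempty ∧ T ⊂ S ∧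
      R.card + T.card = S.card ∧ R.card ≤ T.card ∧ R.card * T.card ≤ 4 * E ∧
      (colourPairsIn c S I).card ≤ (colourPairsIn c R I).card + (colourPairsIn c T I).card ∧
      R.Nonempty := by
    have h1 := hP.card_pos
    have h2 := hP'.card_pos
    rcases le_total P.card (S \ P).card with h | h
    · refine ⟨P, S \ P, hP', ?_, hadd, h, hprod, hsplit, hP⟩
      exact Finset.sdiff_subset.ssubset_of_ne fun h => by rw [h] at hadd; omega
    · refine ⟨S \ P, P, hP, ?_, by omega, h, by rwa [mul_comm], by rwa [add_comm], hP'⟩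
      exact hPS.ssubset_of_ne fun h => by rw [h] at hadd h2; omega
  have hT' := ih T hTS hT
  have hTpos : (0 : ℝ) < T.card := by exact_mod_cast hT.card_pos
  have hSpos : (0 : ℝ) < S.card := by exact_mod_cast hS0
  have hr : ((colourPairsIn c R I).card : ℝ) ≤ R.card * R.card := by
    exact_mod_cast (_root_.card_colourPairsIn_le c R I).trans
      (Nat.mul_le_mul_left _ (Nat.sub_le _ _))
  have hadd' : (R.card : ℝ) + T.card = S.card := by exact_mod_cast hRT
  have hle' : (R.card : ℝ) ≤ T.card := by exact_mod_cast hRT'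
  have hprod'' : (R.card : ℝ) * T.card ≤ 4 * E := by exact_mod_cast hprod'
  -- The share of the smaller side is bounded by the drop of the logarithm, which telescopes along
  -- the larger sides `T`.
  have hl : (R.card : ℝ) / S.card ≤ Real.log S.card - Real.log T.card := by
    have h1 : Real.log (T.card / S.card) ≤ T.card / S.card - 1 :=
      Real.log_le_sub_one_of_pos (by positivity)
    rw [Real.log_div hTpos.ne' hSpos.ne'] at h1
    have h2 : (R.card : ℝ) / S.card = 1 - T.card / S.card := by
      rw [eq_sub_iff_add_eq, ← add_div, hadd', div_self hSpos.ne']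
    linarith
  -- Here `|S| ≤ 2|T|`, as `R` is the smaller side.
  have hRS : (R.card : ℝ) * S.card ≤ 8 * E := by nlinarith
  have hrr : (R.card : ℝ) * R.card ≤ 8 * E * (Real.log S.card - Real.log T.card) := by
    calc (R.card : ℝ) * R.card = R.card * S.card * (R.card / S.card) := by field_simp
      _ ≤ 8 * E * (Real.log S.card - Real.log T.card) := by gcongr
  have hle'' : ((colourPairsIn c S I).card : ℝ)
      ≤ (colourPairsIn c R I).card + (colourPairsIn c T I).card := by exact_mod_cast hle
  nlinarith

end

lemma exists_le_sum_eq {t B E : ℕ} (h : B ≤ t * E) :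
    ∃ g : Fin t → ℕ, (∀ i, g i ≤ E) ∧ ∑ i, g i = B := by
  induction t generalizing B with
  | zero => exact ⟨0, by simp, by simp at h ⊢; omega⟩
  | succ t ih =>
    obtain ⟨g, hg, hs⟩ := ih (B := B - min B E) (by rw [add_mul] at h; omega)
    refine ⟨Fin.cons (min B E) g, fun i => ?_, ?_⟩
    · refine Fin.cases ?_ (fun i => ?_) i
      · simp
      · simpa using hg i
    · rw [Fin.sum_cons, hs]
      omega

lemma card_colourPairsIn_univ {V K : Type*} [Fintype V] [DecidableEq K] (c : V → V → K)
    (F : Finset K) :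
    (colourPairsIn c Finset.univ (F : Set K)).card = ∑ i ∈ F, (colourPairs c {i}).card := by
  classical
  rw [Finset.card_eq_sum_card_fiberwise (f := fun p : V × V => c p.1 p.2) (t := F)
    fun p hp => by
      simp only [colourPairsIn, Finset.coe_filter, Set.mem_ofPred_eq] at hp
      exact hp.2.2]
  refine Finset.sum_congr rfl fun i hi => ?_
  congr 1
  ext ⟨x, y⟩
  simp only [colourPairsIn, colourPairs, Finset.mem_filter, Finset.mem_product, Finset.mem_univ,
    true_and, Set.mem_singleton_iff, Finset.mem_coe]
  constructor
  · rintro ⟨⟨h1, h2⟩, h3⟩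
    exact ⟨h1, h3⟩
  · rintro ⟨h1, rfl⟩
    exact ⟨⟨h1, hi⟩, rfl⟩

/-- With `s` colours of `x` edges each and `t` colours of at most `E` edges each, there is a
distribution that is not realizable. -/
lemma exists_not_realizable {s t x E n : ℕ} (hn : 1 ≤ n) (h1 : s * x ≤ n.choose 2)
    (h2 : n.choose 2 ≤ s * x + t * E)
    (h3 : ((x : ℝ) + 1) * x + 8 * E * Real.log n < 2 * (s * x)) :
    ∃ e : Fin (s + t) → ℕ, ∑ i, e i = n.choose 2 ∧ ¬ Realizable n e := by
  obtain ⟨g, hg, hs⟩ := exists_le_sum_eq (t := t) (B := n.choose 2 - s * x) (E := E) (by omega)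
  refine ⟨Fin.append (fun _ => x) g, ?_, ?_⟩
  · rw [Fin.sum_univ_add]
    simp [hs, h1]
  · rintro ⟨c, hc, hce⟩
    let F : Finset (Fin (s + t)) := Finset.univ.map (Fin.castAddEmb t)
    have hmem : ∀ i : Fin s, Fin.castAdd t i ∈ F := fun i => by simp [F]
    have hF := card_colourPairsIn_univ c F
    rw [Finset.sum_map] at hF
    simp only [Fin.coe_castAddEmb, hce, Fin.append_left, Finset.sum_const, Finset.card_univ,
      Fintype.card_fin, smul_eq_mul] at hF
    have : Nonempty (Fin n) := ⟨⟨0, hn⟩⟩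
    have key := hc.card_colourPairsIn_le (I := (F : Set (Fin (s + t)))) (x := x) (E := E) ?_ ?_
      Finset.univ Finset.univ_nonempty
    · rw [hF, Finset.card_univ, Fintype.card_fin] at key
      push_cast at key
      linarith
    · intro i hi
      simp only [F, Finset.coe_map, Set.mem_image, Finset.coe_univ, Set.mem_univ, true_and,
        Fin.coe_castAddEmb] at hi
      obtain ⟨i, rfl⟩ := hi
      rw [hce, Fin.append_left]
    · intro i
      refine Fin.addCases (fun i hi => absurd (hmem i) hi) (fun i _ => ?_) i
      rw [hce, Fin.append_right]
      exact Nat.mul_le_mul_left 2 (hg i)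

lemma not_allDistributionsGallaiFrom {k n N : ℕ} (hk : 64 ≤ k) (hkn : k ≤ n) (hN : N ≤ n)
    (hlog : 512 * (n : ℝ) ^ 2 * Real.log n < k ^ 3) : ¬ AllDistributionsGallaiFrom k N := by
  intro h
  have : Nonempty (Fin k) := ⟨⟨0, by omega⟩⟩
  -- The rare colours need `2sx ≈ k²/8` ordered pairs, against `(x+1)x ≈ k²/64` and `8 E log n <
  -- k²/32`. The other `t ≥ k/2` colours can hold the remaining edges because `kE ≥ n²`.
  obtain ⟨s, hs⟩ : ∃ s, s = k / 2 := ⟨_, rfl⟩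
  obtain ⟨t, ht⟩ : ∃ t, t = k - s := ⟨_, rfl⟩
  obtain ⟨x, hx⟩ : ∃ x, x = k / 8 := ⟨_, rfl⟩
  obtain ⟨E, hE⟩ : ∃ E, E = n ^ 2 / k + 1 := ⟨_, rfl⟩
  have hkst : s + t = k := by omega
  have hn2 : 2 * n.choose 2 = n * (n - 1) := by
    rw [Nat.choose_two_right, Nat.mul_div_cancel' (Nat.even_mul_pred_self n).two_dvd]
  have h1 : s * x ≤ n.choose 2 := by
    have : 2 * (s * x) ≤ n * (n - 1) := by
      calc 2 * (s * x) = (2 * s) * x := by ring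
        _ ≤ n * (n - 1) := Nat.mul_le_mul (by omega) (by omega)
    omega
  have hkE : n ^ 2 ≤ k * E := hE ▸ (Nat.lt_mul_div_succ (n ^ 2) (by omega)).le
  have h2 : n.choose 2 ≤ s * x + t * E := by
    have h3 : k * E ≤ 2 * t * E := Nat.mul_le_mul_right E (by omega)
    have h4 : n * (n - 1) ≤ n ^ 2 := by rw [sq]; exact Nat.mul_le_mul_left n (Nat.sub_le n 1)
    have h5 : 2 * t * E = 2 * (t * E) := by ring
    omega
  have h3 : ((x : ℝ) + 1) * x + 8 * E * Real.log n < 2 * (s * x) := by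
    have hk0 : (64 : ℝ) ≤ k := by exact_mod_cast hk
    have hkn' : (k : ℝ) ≤ n := by exact_mod_cast hkn
    have hEk : k * E ≤ 2 * n ^ 2 := by
      have := Nat.mul_div_le (n ^ 2) k
      rw [hE]
      nlinarith
    have hEk' : (k : ℝ) * E ≤ 2 * n ^ 2 := by exact_mod_cast hEk
    have hl : 0 ≤ Real.log n := Real.log_natCast_nonneg n
    have h4 : 8 * E * Real.log n < (k : ℝ) ^ 2 / 32 := by
      have : k * (8 * E * Real.log n) < k * ((k : ℝ) ^ 2 / 32) := by
        calc k * (8 * E * Real.log n) = 8 * (k * E) * Real.log n := by ring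
          _ ≤ 8 * (2 * n ^ 2) * Real.log n := by gcongr
          _ < k * ((k : ℝ) ^ 2 / 32) := by linarith
      exact lt_of_mul_lt_mul_left this (by linarith)
    have hs1 : (k : ℝ) ≤ 2 * s + 1 := by exact_mod_cast (by omega : k ≤ 2 * s + 1)
    have hx1 : (k : ℝ) ≤ 16 * x := by exact_mod_cast (by omega : k ≤ 16 * x)
    have hx2 : 8 * (x : ℝ) ≤ k := by exact_mod_cast (by omega : 8 * x ≤ k)
    nlinarith
  obtain ⟨e, he, hne⟩ := exists_not_realizable (by omega) h1 h2 h3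
  subst hkst
  exact hne ((exists_gallaiColouring_iff_realizable n e).1 (h n hN e he))

/-! ### Asymptotics of the threshold -/

lemma gallaiThreshold_le {k N : ℕ} (h : AllDistributionsGallaiFrom k N) :
    gallaiThreshold k ≤ N :=
  sInf_le ⟨N, h, rfl⟩

/-- Finiteness is essential here, because `toNat` sends `⊤` to `0`. -/
lemma lt_toNat_gallaiThreshold {k n : ℕ} (hk : gallaiThreshold k ≠ ⊤)
    (h : ∀ N ≤ n, ¬ AllDistributionsGallaiFrom k N) : n < (gallaiThreshold k).toNat := by
  have hne : ((fun N : ℕ => (N : ℕ∞)) '' {N : ℕ | AllDistributionsGallaiFrom k N}).Nonempty := by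
    rw [Set.nonempty_iff_ne_empty]
    intro h0
    exact hk (by rw [gallaiThreshold, h0, sInf_empty])
  obtain ⟨N, hN, hNe⟩ := csInf_mem hne
  have : gallaiThreshold k = N := hNe.symm
  rw [this, ENat.toNat_natCast]
  by_contra! hcon
  exact h N hcon hN

/-- The order of magnitude in terms of `t = k ^ (1 / 8)`. -/
lemma eventually_rate : ∀ᶠ k : ℕ in Filter.atTop, ∃ t : ℝ, 64 ≤ t ∧ (k : ℝ) = t ^ 8 ∧
    Real.log k = 8 * Real.log t ∧ 1 ≤ Real.log k ∧
    √(Real.log k) ≤ t ^ 2 / 4 ∧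
    (k : ℝ) ^ (1.5 : ℝ) / (Real.log k) ^ (0.5 : ℝ) = t ^ 12 / √(Real.log k) := by
  have e1 : ∀ᶠ k : ℕ in Filter.atTop, ‖Real.log k‖ ≤ 1 / 16 * ‖(k : ℝ) ^ (1 / 2 : ℝ)‖ :=
    ((isLittleO_log_rpow_atTop (by norm_num : (0 : ℝ) < 1 / 2)).comp_tendsto
      tendsto_natCast_atTop_atTop).bound (by norm_num)
  filter_upwards [e1, Filter.eventually_ge_atTop (64 ^ 8)] with k h1 h2
  have hk : ((64 : ℝ) ^ 8) ≤ k := by exact_mod_cast h2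
  have hk0 : (0 : ℝ) < k := lt_of_lt_of_le (by norm_num) hk
  have ht : ((k : ℝ) ^ (1 / 8 : ℝ)) ^ 8 = k := by
    rw [← Real.rpow_natCast, ← Real.rpow_mul hk0.le]
    norm_num
  have hlog1 : 1 ≤ Real.log k := by
    rw [Real.le_log_iff_exp_le hk0]
    exact (Real.exp_one_lt_d9.le.trans (by norm_num)).trans hk
  have hsq : (k : ℝ) ^ (1 / 2 : ℝ) = ((k : ℝ) ^ (1 / 8 : ℝ)) ^ 4 := by
    rw [← Real.rpow_natCast, ← Real.rpow_mul hk0.le]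
    norm_num
  refine ⟨(k : ℝ) ^ (1 / 8 : ℝ), ?_, ht.symm, ?_, hlog1, ?_, ?_⟩
  · refine le_of_pow_le_pow_left₀ (n := 8) (by norm_num) (by positivity) ?_
    rwa [ht]
  · rw [Real.log_rpow hk0]; ring
  · rw [Real.norm_of_nonneg (by linarith), Real.norm_of_nonneg (by positivity), hsq] at h1
    refine Real.sqrt_le_iff.2 ⟨by positivity, ?_⟩
    linarith
  · have h15 : (k : ℝ) ^ (1.5 : ℝ) = ((k : ℝ) ^ (1 / 8 : ℝ)) ^ 12 := by
      rw [← Real.rpow_natCast, ← Real.rpow_mul hk0.le]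
      norm_num
    rw [h15, Real.sqrt_eq_rpow]
    norm_num

lemma eventually_allDistributionsGallaiFrom : ∀ᶠ k : ℕ in Filter.atTop,
    ∃ N : ℕ, AllDistributionsGallaiFrom k N ∧
      (N : ℝ) ≤ 512 * ((k : ℝ) ^ (1.5 : ℝ) / (Real.log k) ^ (0.5 : ℝ)) := by
  filter_upwards [eventually_rate, Filter.eventually_ge_atTop 1] with k
    ⟨t, ht, hkt, hlt, hl, hs, hr⟩ hk1
  have : Nonempty (Fin k) := ⟨⟨0, hk1⟩⟩
  rw [hr]
  have ht0 : 0 < t := by linarith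
  have hsl : 1 ≤ √(Real.log k) := Real.one_le_sqrt.2 hl
  set φ := t ^ 12 / √(Real.log k) with hφ
  have hφl : 4 * t ^ 10 ≤ φ := by
    rw [hφ, le_div_iff₀ (by positivity)]
    calc 4 * t ^ 10 * √(Real.log k) ≤ 4 * t ^ 10 * (t ^ 2 / 4) := by gcongr
      _ = t ^ 12 := by ring
  have hφu : φ ≤ t ^ 12 := div_le_self (by positivity) hsl
  have hφ2 : φ ^ 2 * Real.log k = t ^ 24 := by
    rw [hφ, div_pow, Real.sq_sqrt (by linarith)]
    field_simp
  have ht10 : 1 ≤ t ^ 10 := one_le_pow₀ (by linarith)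
  have ht2 : 64 * 64 ≤ t ^ 2 := by nlinarith
  have hnl : 256 * φ ≤ ⌈256 * φ⌉₊ := Nat.le_ceil _
  have hnu : (⌈256 * φ⌉₊ : ℝ) ≤ 512 * φ := by
    have := Nat.ceil_lt_add_one (a := 256 * φ) (by positivity)
    linarith
  set n := ⌈256 * φ⌉₊
  refine ⟨n, allDistributionsGallaiFrom_of_realizable hk1 ?_ fun e he =>
    realizable_of_bounds (t := t) he ht ?_ ?_ ?_, hnu⟩
  · have : 2 * (k : ℝ) ≤ n := by
      rw [hkt]
      have : t ^ 8 ≤ t ^ 10 := pow_le_pow_right₀ (by linarith) (by norm_num)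
      linarith
    exact_mod_cast this
  · rw [Fintype.card_fin, hkt, ← pow_add]
    norm_num only
    linarith
  · rw [Fintype.card_fin, hkt]
    calc (n : ℝ) * t ^ 2 ≤ 512 * t ^ 12 * t ^ 2 := by gcongr; linarith
      _ = 128 * t ^ 14 * 4 := by ring
      _ ≤ 128 * t ^ 14 * t ^ 2 := by gcongr; linarith
      _ = 128 * (t ^ 8) ^ 2 := by ring
  · have h1 : Real.log k / 16 ≤ Real.log (t / 8) := by
      rw [Real.log_div ht0.ne' (by norm_num), hlt]
      have : Real.log (8 ^ 2) ≤ Real.log t := Real.log_le_log (by norm_num) (by linarith)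
      rw [Real.log_pow] at this
      push_cast at this
      linarith
    rw [Fintype.card_fin]
    -- The factor 256 is chosen so that `256² / 16 = 4096`.
    calc 4096 * (k : ℝ) ^ 3 = 4096 * t ^ 24 := by rw [hkt]; ring
      _ = (256 * φ) ^ 2 * (Real.log k / 16) := by rw [← hφ2]; ring
      _ ≤ (n : ℝ) ^ 2 * (Real.log k / 16) := by gcongr
      _ ≤ (n : ℝ) ^ 2 * Real.log (t / 8) := by gcongr

lemma eventually_not_allDistributionsGallaiFrom : ∀ᶠ k : ℕ in Filter.atTop,
    ∀ N ≤ ⌊(k : ℝ) ^ (1.5 : ℝ) / (Real.log k) ^ (0.5 : ℝ) / 64⌋₊,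
      ¬ AllDistributionsGallaiFrom k N := by
  filter_upwards [eventually_rate, Filter.eventually_ge_atTop 64] with k
    ⟨t, ht, hkt, hlt, hl, hs, hr⟩ hk N hN
  rw [hr] at hN
  have ht0 : 0 < t := by linarith
  have hsl : 1 ≤ √(Real.log k) := Real.one_le_sqrt.2 hl
  set φ := t ^ 12 / √(Real.log k) with hφ
  have hφl : 4 * t ^ 10 ≤ φ := by
    rw [hφ, le_div_iff₀ (by positivity)]
    calc 4 * t ^ 10 * √(Real.log k) ≤ 4 * t ^ 10 * (t ^ 2 / 4) := by gcongr
      _ = t ^ 12 := by ring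
  have hφu : φ ≤ t ^ 12 := div_le_self (by positivity) hsl
  have hφ2 : φ ^ 2 * Real.log k = t ^ 24 := by
    rw [hφ, div_pow, Real.sq_sqrt (by linarith)]
    field_simp
  have hφ0 : 0 ≤ φ := by positivity
  have ht8 : 1 ≤ t ^ 8 := one_le_pow₀ (by linarith)
  have ht2 : 64 * 64 ≤ t ^ 2 := by nlinarith
  have hnu : (⌊φ / 64⌋₊ : ℝ) ≤ φ / 64 := Nat.floor_le (by positivity)
  have hnl : φ / 64 < ⌊φ / 64⌋₊ + 1 := Nat.lt_floor_add_one _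
  set n := ⌊φ / 64⌋₊
  have hkn : (k : ℝ) ≤ n := by
    have : t ^ 8 * (64 * 64) ≤ t ^ 8 * t ^ 2 := by gcongr
    have : t ^ 10 = t ^ 8 * t ^ 2 := by ring
    rw [hkt]
    linarith
  have hn0 : (0 : ℝ) < n := by linarith
  have hlogn : Real.log n ≤ 2 * Real.log k := by
    have : Real.log n ≤ Real.log (t ^ 12) := Real.log_le_log hn0 (by linarith)
    rw [Real.log_pow] at this
    push_cast at this
    linarith
  refine not_allDistributionsGallaiFrom hk (by exact_mod_cast hkn) hN ?_
  -- The divisor 64 leaves the factor `512 · 2 / 64² = 1/4`.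
  calc 512 * (n : ℝ) ^ 2 * Real.log n ≤ 512 * (φ / 64) ^ 2 * (2 * Real.log k) := by gcongr
    _ = φ ^ 2 * Real.log k / 4 := by ring
    _ = t ^ 24 / 4 := by rw [hφ2]
    _ < t ^ 24 := by linarith [pow_pos ht0 24]
    _ = (k : ℝ) ^ 3 := by rw [hkt]; ring

theorem theorem1p2 :
    (∀ k : ℕ, 1 ≤ k → gallaiThreshold k ≠ ⊤) ∧
      Asymptotics.IsTheta Filter.atTop
        (fun k : ℕ => ((gallaiThreshold k).toNat : ℝ))
        (fun k : ℕ => (k : ℝ) ^ (1.5 : ℝ) / (Real.log (k : ℝ)) ^ (0.5 : ℝ)) := by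
  have hfin : ∀ k : ℕ, 1 ≤ k → gallaiThreshold k ≠ ⊤ := by
    intro k hk
    obtain ⟨k', ⟨N, hN, -⟩, hk'⟩ :=
      (eventually_allDistributionsGallaiFrom.and (Filter.eventually_ge_atTop k)).exists
    exact ne_top_of_le_ne_top (ENat.natCast_ne_top N) (gallaiThreshold_le (hN.mono hk hk'))
  refine ⟨hfin, Asymptotics.IsBigO.of_bound 512 ?_, Asymptotics.IsBigO.of_bound 64 ?_⟩
  · filter_upwards [eventually_allDistributionsGallaiFrom] with k ⟨N, hN, hle⟩
    have h1 : (gallaiThreshold k).toNat ≤ N :=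
      ENat.toNat_le_of_le_natCast (gallaiThreshold_le hN)
    have h2 : ((gallaiThreshold k).toNat : ℝ) ≤ N := by exact_mod_cast h1
    rw [Real.norm_of_nonneg (by positivity)]
    refine (h2.trans hle).trans ?_
    gcongr
    exact Real.le_norm_self _
  · filter_upwards [eventually_not_allDistributionsGallaiFrom, Filter.eventually_ge_atTop 1]
      with k h hk
    have h1 := lt_toNat_gallaiThreshold (hfin k hk) h
    have h2 := Nat.lt_of_floor_lt h1
    have h3 : 0 ≤ Real.log k := Real.log_natCast_nonneg k
    rw [Real.norm_of_nonneg (by positivity), Real.norm_of_nonneg (by positivity)]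
    linarith
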